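/- Let $E$ be a separable real Banach space with open unit ball $B$, let $\mathbb{R}_+=[0,\infty)$ carry Lebesgue measure and the Lebesgue $\sigma$-algebra $\mathcal L$, let $L:\mathbb{R}_+\times E\times E\to\mathbb{R}\cup\{+\infty\}$ be an integrand and $\Gamma:\mathbb{R}_+\times E\twoheadrightarrow E$ a multifunction. Let $W^{1,1}_{\mathrm{loc}}(\mathbb{R}_+,E)$ be the set of locally Bochner integrable $x:\mathbb{R}_+\to E$ whose strong derivative $\dot x(t)$ exists for a.e. $t>0$, is locally Bochner integrable, and satisfies $x(t)=x(0)+\int_0^t\dot x(s)\,ds$ for all $t\ge 0$. For $(t,\xi)\in\mathbb{R}_+\times E$ put $$\mathcal{A}_{(t,\xi)}=\{x\in W^{1,1}_{\mathrm{loc}}(\mathbb{R}_+,E) : \dot x(s)\in\Gamma(s,x(s))\ \text{for a.e. } s\in[t,\infty),\ x(t)=\xi\},$$ $$V(t,\xi)=\inf_{x\in\mathcal{A}_{(t,\xi)}}\int_t^\infty L(s,x(s),\dot x(s))\,ds,\qquad \int_t^\infty=\lim_{T\to\infty}\int_t^T,$$ where the infimum runs over those $x$ for which the improper integral is well defined,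 and $\inf\emptyset=+\infty$. Assume: * (H1) $\mathcal{A}_{(t,\xi)}\neq\emptyset$ for every $(t,\xi)\in\mathbb{R}_+\times E$. * (H2) $L(\cdot,x,y)$ is measurable for every $(x,y)\in E\times E$. * (H3) There are integrable $l_0,l_1:\mathbb{R}_+\to\mathbb{R}_+$ and a locally bounded integrable $l_2:\mathbb{R}_+\to\mathbb{R}_+$ such that, for a.e. $t\in\mathbb{R}_+$, $|L(t,0,0)|\le l_0(t)$ and $|L(t,x,y)-L(t,x',y')|\le l_1(t)\|x-x'\|+l_2(t)\|y-y'\|$ for all $(x,y),(x',y')\in E\times E$. * (H4) $\Gamma$ has nonempty closed values. * (H5) For every $x\in E$ and every open $U\subset E$, $\{t\in\mathbb{R}_+:\Gamma(t,x)\cap U\neq\emptyset\}\in\mathcal L$. * (H6) There are locally integrable $\gamma_0,\gamma_1:\mathbb{R}_+\to\mathbb{R}_+$ such that $\Gamma(t,0)\subset\gamma_0(t)B$ and $\Gamma(t,x)\subset\Gamma(t,x')+\gamma_1(t)\|x-x'\|B$ for every $t\in\mathbb{R}_+$ and $x,x'\in E$. * (H7) These functions satisfy $\int_0^\infty \exp\left(\int_0^s\gamma_1(\tau)\,d\tau\right)\left(1+\int_0^s\gamma_0(\tau)\,d\tau\right)\left(l_1(s)+l_2(s)\gamma_1(s)\right)ds<\infty$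 and $\int_0^\infty l_2(s)\gamma_0(s)\,ds<\infty$. Then $V$ is real-valued on $\mathbb{R}_+\times E$, bounded on $\mathbb{R}_+\times D$ for every bounded set $D\subset E$, and lower semicontinuous on $\mathbb{R}_+\times E$. Moreover, there is a continuous decreasing (i.e. nonincreasing) function $k:\mathbb{R}_+\to\mathbb{R}_+$ with $k(t)\to0$ as $t\to\infty$ such that $|V(t,\xi)-V(t,\xi')|\le k(t)\|\xi-\xi'\|$ for every $t\in\mathbb{R}_+$ and $\xi,\xi'\in E$. -/

import Mathlib

open MeasureTheory Set Filter Topology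
open scoped ENNReal Pointwise

noncomputable section

/-- `x ∈ W^{1,1}_loc(ℝ₊, E)`. Functions on `ℝ₊ = [0, ∞)` are represented by functions on `ℝ`,
and only their values on `[0, ∞)` are used; the strong derivative at `t > 0` is `deriv x t`. -/
structure IsArc {E : Type*} [NormedAddCommGroup E] [NormedSpace ℝ E] (x : ℝ → E) : Prop where
  locallyIntegrable : LocallyIntegrableOn x (Ici 0) volume
  ae_differentiable : ∀ᵐ t ∂(volume.restrict (Ioi (0 : ℝ))), DifferentiableAt ℝ x t
  locallyIntegrable_deriv : LocallyIntegrableOn (deriv x) (Ici 0) volume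
  eq_integral : ∀ t, 0 ≤ t → x t = (∫ s in (0 : ℝ)..t, deriv x s) + x 0

/-- The set `𝒜_(t,ξ)` of admissible trajectories for the multifunction `Γ` starting at time `t`
from `ξ`. -/
def admissible {E : Type*} [NormedAddCommGroup E] [NormedSpace ℝ E]
    (Γ : ℝ → E → Set E) (t : ℝ) (ξ : E) : Set (ℝ → E) :=
  {x | IsArc x ∧ (∀ᵐ s ∂(volume.restrict (Ici t)), deriv x s ∈ Γ s (x s)) ∧ x t = ξ}

/-- The Lebesgue integral over `[a, b]` of an extended real-valued function, as the integral of
the positive part minus the integral of the negative part. -/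
def extIntegral (f : ℝ → EReal) (a b : ℝ) : EReal :=
  ((∫⁻ s in Icc a b, (f s).toENNReal : ℝ≥0∞) : EReal)
    - ((∫⁻ s in Icc a b, (-f s).toENNReal : ℝ≥0∞) : EReal)

/-- The Lebesgue integral of `f` over `[a, b]` is well defined: `f` is measurable and its positive
and negative parts do not both have infinite integral. -/
def ExtIntegralDefined (f : ℝ → EReal) (a b : ℝ) : Prop :=
  AEMeasurable f (volume.restrict (Icc a b)) ∧
    ((∫⁻ s in Icc a b, (f s).toENNReal) ≠ ∞ ∨ (∫⁻ s in Icc a b, (-f s).toENNReal) ≠ ∞)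

/-- The improper integral `∫_t^∞ f(s) ds = lim_{T → ∞} ∫_t^T f(s) ds` is well defined and its
value is `I`. -/
def HasImproperIntegral (f : ℝ → EReal) (t : ℝ) (I : EReal) : Prop :=
  (∀ T, t ≤ T → ExtIntegralDefined f t T) ∧
    Tendsto (fun T => extIntegral f t T) atTop (𝓝 I)

/-- The value function: the infimum of the improper integrals `∫_t^∞ L(s, x(s), ẋ(s)) ds` over
those admissible trajectories for which the integral is well defined (with `inf ∅ = +∞`). -/
def valueFunction {E : Type*} [NormedAddCommGroup E] [NormedSpace ℝ E]
    (L : ℝ → E → E → EReal) (Γ : ℝ → E → Set E) (t : ℝ) (ξ : E) : EReal :=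
  sInf {I : EReal | ∃ x ∈ admissible Γ t ξ,
    HasImproperIntegral (fun s => L s (x s) (deriv x s)) t I}

end

/-! ### Integration, Gronwall, measurability and arcs -/

section Analysis

variable {E : Type*} [NormedAddCommGroup E]

/-! Two estimates on trajectories carry the proof. The first is a growth bound: velocities in `Γ s
x` have norm at most `γ₀ s + γ₁ s * ‖x‖`, so Gronwall (`norm_le_growth`) bounds every admissible
trajectory by a multiple of the weight exp(∫γ₁)(1 + ∫γ₀) of (H7). Its running cost is then dominated
by one integrable function depending only on a bound for ‖ξ‖ (`ae_abs_cost_le`,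
`integrableOn_costBound`), which gives finiteness and boundedness of V.

The second is Filippov's theorem on the half-line (`exists_neighboring_trajectory`): a trajectory
from ξ is followed by one from ξ' within (‖ξ - ξ'‖ + η) exp(∫γ₁), with a matching bound on
velocities. Integrating the Lipschitz estimate for L and letting η → 0 shows that V(t, ·) is
Lipschitz with rank k(t), the integral over (t, ∞) of exp(∫₀ˢγ₁)(l₁ + l₂γ₁). As the tail of a
convergent integral of a nonnegative function, k is continuous, nonincreasing and tends to 0.

No convexity or compactness is available, so infima need not be attained, and lower semicontinuity
does not come from limits of minimizers. V is in fact continuous: dynamic programming controls its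
change in time by the cost and the displacement over a short interval, and the Lipschitz bound
controls the change in state. Finally (H3) makes L real-valued almost everywhere in time, so the
extended-real infimum is that of ordinary integrals (`valueFunction_eq`). -/

theorem locallyIntegrable_indicator_of_locallyIntegrableOn {f : ℝ → E} {a : ℝ}
    (hf : LocallyIntegrableOn f (Ici a) volume) :
    LocallyIntegrable ((Ici a).indicator f) volume := by
  rw [locallyIntegrable_iff]
  intro K hK
  rw [IntegrableOn, integrable_indicator_iff measurableSet_Ici, IntegrableOn,
    Measure.restrict_restrict measurableSet_Ici]
  exact hf.integrableOn_compact_subset inter_subset_left (hK.inter_left isClosed_Ici)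

theorem MeasureTheory.LocallyIntegrable.intervalIntegrable_real {f : ℝ → E}
    (hf : LocallyIntegrable f volume) (a b : ℝ) : IntervalIntegrable f volume a b :=
  intervalIntegrable_iff.mpr <|
    (hf.integrableOn_isCompact isCompact_uIcc).mono_set uIoc_subset_uIcc

variable [NormedSpace ℝ E]

theorem MeasureTheory.LocallyIntegrable.continuous_integral {f : ℝ → E}
    (hf : LocallyIntegrable f volume) (a : ℝ) : Continuous fun s => ∫ τ in a..s, f τ :=
  intervalIntegral.continuous_primitive hf.intervalIntegrable_real a

theorem integral_indicator_Ici_interval (f : ℝ → E) {a s t : ℝ} (hs : a ≤ s) (ht : a ≤ t) :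
    ∫ τ in s..t, (Ici a).indicator f τ = ∫ τ in s..t, f τ := by
  refine intervalIntegral.integral_congr fun τ hτ => ?_
  have : a ≤ τ := (le_min hs ht).trans hτ.1
  simp [indicator_of_mem (show τ ∈ Ici a from this)]

/-- The integrand is almost everywhere the derivative of the monotone function exp(∫γ), and the
integral of the derivative of a monotone function never exceeds its increment. Only this inequality
is needed, so absolute continuity is not invoked. -/
theorem integral_mul_exp_integral_le {γ : ℝ → ℝ} (hγ : LocallyIntegrable γ volume)
    (hγ0 : ∀ s, 0 ≤ γ s) {a b : ℝ} (hab : a ≤ b) :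
    ∫ s in a..b, γ s * Real.exp (∫ τ in a..s, γ τ) ≤ Real.exp (∫ τ in a..b, γ τ) - 1 := by
  have hmono : Monotone fun s => Real.exp (∫ τ in a..s, γ τ) := by
    intro s t hst
    refine Real.exp_le_exp.2 ?_
    rw [← sub_nonneg, intervalIntegral.integral_interval_sub_left
      (hγ.intervalIntegrable_real _ _) (hγ.intervalIntegrable_real _ _)]
    exact intervalIntegral.integral_nonneg hst fun u _ => hγ0 u
  have h := (hmono.monotoneOn (uIcc a b)).intervalIntegral_deriv_mem_uIcc
  rw [uIcc_of_le (sub_nonneg.2 (hmono hab))] at h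
  refine le_trans (le_of_eq ?_) (h.2.trans (by simp))
  refine intervalIntegral.integral_congr_ae ?_
  filter_upwards [_root_.LocallyIntegrable.ae_hasDerivAt_integral hγ] with s hs _
  rw [((hs a).exp).deriv, mul_comm]

/-- Let K be the maximum of u·exp(-m), attained at p, where m = ∫γ. If K > 0, the hypothesis at p
reads K exp(m p) ≤ A + K (exp(m p) - 1), that is, K ≤ A. -/
theorem gronwall_integral {γ u : ℝ → ℝ} (hγ : LocallyIntegrable γ volume)
    (hγ0 : ∀ s, 0 ≤ γ s) {a b A : ℝ} (hu : ContinuousOn u (Icc a b))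
    (hA : 0 ≤ A) (h : ∀ s ∈ Icc a b, u s ≤ A + ∫ τ in a..s, γ τ * u τ) :
    ∀ s ∈ Icc a b, u s ≤ A * Real.exp (∫ τ in a..s, γ τ) := by
  intro s hs
  set m : ℝ → ℝ := fun s => ∫ τ in a..s, γ τ with hm
  have hmc : Continuous m := hγ.continuous_integral a
  obtain ⟨p, hp, hmax⟩ := isCompact_Icc.exists_isMaxOn ⟨s, hs⟩
    (hu.mul ((hmc.neg.rexp).continuousOn (s := Icc a b)))
  set K : ℝ := u p * Real.exp (-m p) with hK
  have hle : ∀ τ ∈ Icc a b, u τ ≤ K * Real.exp (m τ) := by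
    intro τ hτ
    have := hmax hτ
    have h2 : u τ * Real.exp (-m τ) ≤ K := this
    calc u τ = u τ * Real.exp (-m τ) * Real.exp (m τ) := by
          rw [mul_assoc, ← Real.exp_add]; simp
      _ ≤ _ := by gcongr
  have hKA : K ≤ A ∨ K ≤ 0 := by
    by_cases hK0 : K ≤ 0
    · exact Or.inr hK0
    left
    push Not at hK0
    have h1 := h p hp
    have h2 : ∫ τ in a..p, γ τ * u τ ≤ ∫ τ in a..p, K * (γ τ * Real.exp (m τ)) := by
      refine intervalIntegral.integral_mono_on hp.1 ?_ ?_ ?_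
      · refine (hγ.intervalIntegrable_real a p).mul_continuousOn ?_
        rw [uIcc_of_le hp.1]
        exact hu.mono (Icc_subset_Icc_right hp.2)
      · exact ((hγ.intervalIntegrable_real a p).mul_continuousOn hmc.rexp.continuousOn).const_mul K
      · intro τ hτ
        have := hle τ ⟨hτ.1, hτ.2.trans hp.2⟩
        calc γ τ * u τ ≤ γ τ * (K * Real.exp (m τ)) := mul_le_mul_of_nonneg_left this (hγ0 τ)
          _ = _ := by ring
    rw [intervalIntegral.integral_const_mul] at h2
    have h3 := mul_le_mul_of_nonneg_left (integral_mul_exp_integral_le hγ hγ0 hp.1) hK0.le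
    have h4 : u p = K * Real.exp (m p) := by
      rw [hK, mul_assoc, ← Real.exp_add]; simp
    simp only [hm] at *
    linarith
  refine (hle s hs).trans ?_
  have := Real.exp_pos (m s)
  rcases hKA with h | h
  · gcongr
  · exact (mul_nonpos_of_nonpos_of_nonneg h this.le).trans (by positivity)

/-- Composition of a Carathéodory function with a measurable function. -/
theorem aemeasurable_caratheodory {α F : Type*} [MeasurableSpace α] {μ : Measure α}
    [TopologicalSpace F] {G : α → F → ℝ} (hG : ∀ y, AEMeasurable (fun s => G s y) μ)
    (hc : ∀ᵐ s ∂μ, Continuous (G s)) {h : α → F} (hh : AEStronglyMeasurable h μ) :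
    AEMeasurable (fun s => G s (h s)) μ := by
  have hmk : AEMeasurable (fun s => G s (hh.mk h s)) μ := by
    have hs := hh.stronglyMeasurable_mk
    -- Simple functions reduce the claim to finitely many level sets, on each of which the second
    -- argument is constant.
    refine aemeasurable_of_tendsto_metrizable_ae atTop (f := fun n s => G s (hs.approx n s)) ?_ ?_
    · intro n
      set φ := hs.approx n
      have hcov : (⋃ c : φ.range, φ ⁻¹' {(c : F)}) = univ := by
        ext s; simp
      rw [← Measure.restrict_univ (μ := μ), ← hcov, aemeasurable_iUnion_iff]
      rintro ⟨c, _⟩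
      refine (hG c).restrict.congr ?_
      filter_upwards [ae_restrict_mem (φ.measurableSet_preimage {c})] with s hs
      have : φ s = c := hs
      rw [this]
    · filter_upwards [hc] with s hs'
      exact (hs'.tendsto _).comp (hs.tendsto_approx s)
  refine hmk.congr ?_
  filter_upwards [hh.ae_eq_mk] with s hs
  rw [hs]

/-- A countable family of null measurable sets covering almost every point admits a measurable
choice of index. -/
theorem exists_measurable_index {α : Type*} [MeasurableSpace α] {μ : Measure α} {A : ℕ → Set α}
    (hA : ∀ m, NullMeasurableSet (A m) μ) (hcov : ∀ᵐ s ∂μ, ∃ m, s ∈ A m) :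
    ∃ N : α → ℕ, Measurable N ∧ ∀ᵐ s ∂μ, s ∈ A (N s) := by
  classical
  choose B hBm hB using fun m => (hA m).exists_measurable_superset_ae_eq.imp fun _ h => h.2
  set U : Set α := ⋃ m, B m
  have hU : MeasurableSet U := MeasurableSet.iUnion hBm
  -- The alternative `s ∉ U` makes the least index exist at every point, not only almost everywhere.
  have hp : ∀ s, ∃ m, s ∈ B m ∨ s ∉ U := by
    intro s
    by_cases hs : s ∈ U
    · obtain ⟨m, hm⟩ := mem_iUnion.1 hs
      exact ⟨m, Or.inl hm⟩
    · exact ⟨0, Or.inr hs⟩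
  refine ⟨fun s => Nat.find (hp s), measurable_find hp fun k => (hBm k).union hU.compl, ?_⟩
  have hall : ∀ᵐ s ∂μ, ∀ m, (s ∈ B m ↔ s ∈ A m) := by
    rw [ae_all_iff]
    intro m
    filter_upwards [hB m] with s hs
    exact iff_of_eq hs
  filter_upwards [hall, hcov] with s hs ⟨m, hm⟩
  rcases Nat.find_spec (hp s) with h | h
  · exact (hs _).1 h
  · exact absurd (mem_iUnion.2 ⟨m, (hs m).2 hm⟩) h

theorem aestronglyMeasurable_deriv_of_isArc {x : ℝ → E} (hx : IsArc x) :
    AEStronglyMeasurable (deriv x) (volume.restrict (Ici 0)) :=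
  hx.locallyIntegrable_deriv.aestronglyMeasurable

theorem IsArc.eq_add_integral {x : ℝ → E} (hx : IsArc x) {t s : ℝ} (ht : 0 ≤ t) (hs : 0 ≤ s) :
    x s = x t + ∫ τ in t..s, (Ici 0).indicator (deriv x) τ := by
  have hi := (locallyIntegrable_indicator_of_locallyIntegrableOn
    hx.locallyIntegrable_deriv).intervalIntegrable_real
  rw [hx.eq_integral s hs, hx.eq_integral t ht, ← integral_indicator_Ici_interval _ le_rfl ht,
    ← integral_indicator_Ici_interval _ le_rfl hs,
    ← intervalIntegral.integral_add_adjacent_intervals (hi 0 t) (hi t s)]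
  abel

theorem IsArc.continuousOn {x : ℝ → E} (hx : IsArc x) : ContinuousOn x (Ici 0) := by
  have h := (locallyIntegrable_indicator_of_locallyIntegrableOn
    hx.locallyIntegrable_deriv).continuous_integral 0
  exact (continuous_const.add h).continuousOn.congr fun s hs => hx.eq_add_integral le_rfl hs

theorem deriv_primitive_ae_eq [CompleteSpace E] {g : ℝ → E} (hg : LocallyIntegrable g volume)
    (a : ℝ) (c : E) : deriv (fun s => c + ∫ τ in a..s, g τ) =ᵐ[volume] g := by
  filter_upwards [_root_.LocallyIntegrable.ae_hasDerivAt_integral hg] with s hs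
  exact ((hs a).const_add c).deriv

theorem isArc_primitive [CompleteSpace E] {g : ℝ → E} (hg : LocallyIntegrable g volume)
    (a : ℝ) (c : E) : IsArc fun s => c + ∫ τ in a..s, g τ where
  locallyIntegrable :=
    (continuous_const.add (hg.continuous_integral a)).locallyIntegrable.locallyIntegrableOn _
  ae_differentiable := by
    refine ae_restrict_of_ae ?_
    filter_upwards [_root_.LocallyIntegrable.ae_hasDerivAt_integral hg] with s hs
    exact ((hs a).const_add c).differentiableAt
  locallyIntegrable_deriv :=
    (hg.congr (deriv_primitive_ae_eq hg a c).symm).locallyIntegrableOn _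
  eq_integral t _ := by
    have hi := hg.intervalIntegrable_real
    have hd : ∫ s in (0 : ℝ)..t, deriv (fun s => c + ∫ τ in a..s, g τ) s = ∫ s in (0 : ℝ)..t, g s :=
      intervalIntegral.integral_congr_ae
        (by filter_upwards [deriv_primitive_ae_eq hg a c] with s hs _ using hs)
    rw [hd, ← intervalIntegral.integral_add_adjacent_intervals (hi a 0) (hi 0 t)]
    abel

end Analysis

/-! ### Lipschitz multifunctions and Picard-type iterates -/

section Filippov

variable {E : Type*} [NormedAddCommGroup E]

/-- A measurable multifunction with nonempty closed values which is Lipschitz in the state, with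
locally integrable Lipschitz rank `γ₁` and with `Γ s 0` bounded by `γ₀ s`. -/
structure IsLipschitzMultifunction (Γ : ℝ → E → Set E) (γ₀ γ₁ : ℝ → ℝ) : Prop where
  γ₀_nonneg : ∀ s, 0 ≤ γ₀ s
  γ₀_locallyIntegrable : LocallyIntegrable γ₀ volume
  γ₁_nonneg : ∀ s, 0 ≤ γ₁ s
  γ₁_locallyIntegrable : LocallyIntegrable γ₁ volume
  nonempty : ∀ s, 0 ≤ s → ∀ x, (Γ s x).Nonempty
  isClosed : ∀ s, 0 ≤ s → ∀ x, IsClosed (Γ s x)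
  aemeasurable_infDist : ∀ x q,
    AEMeasurable (fun s => Metric.infDist q (Γ s x)) (volume.restrict (Ici 0))
  norm_le : ∀ s, 0 ≤ s → ∀ y ∈ Γ s 0, ‖y‖ ≤ γ₀ s
  exists_norm_sub_le : ∀ s, 0 ≤ s → ∀ x x', ∀ y ∈ Γ s x, ∃ y' ∈ Γ s x',
    ‖y - y'‖ ≤ γ₁ s * ‖x - x'‖

variable {Γ : ℝ → E → Set E} {γ₀ γ₁ : ℝ → ℝ}

namespace IsLipschitzMultifunction

theorem infDist_le (hΓ : IsLipschitzMultifunction Γ γ₀ γ₁) {s : ℝ} (hs : 0 ≤ s) (q x x' : E) :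
    Metric.infDist q (Γ s x') ≤ Metric.infDist q (Γ s x) + γ₁ s * ‖x - x'‖ := by
  refine le_of_forall_pos_lt_add fun ε hε => ?_
  obtain ⟨y, hy, hqy⟩ := (Metric.infDist_lt_iff (hΓ.nonempty s hs x)).1
    (lt_add_of_pos_right (Metric.infDist q (Γ s x)) hε)
  obtain ⟨y', hy', hyy'⟩ := hΓ.exists_norm_sub_le s hs x x' y hy
  have h1 := Metric.infDist_le_dist_of_mem (x := q) hy'
  have h2 := dist_triangle q y y'
  rw [dist_eq_norm y y'] at h2
  linarith

theorem continuous_infDist (hΓ : IsLipschitzMultifunction Γ γ₀ γ₁) {s : ℝ} (hs : 0 ≤ s) (q : E) :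
    Continuous fun x => Metric.infDist q (Γ s x) := by
  refine (LipschitzWith.of_le_add_mul ⟨γ₁ s, hΓ.γ₁_nonneg s⟩ fun x y => ?_).continuous
  rw [dist_comm, dist_eq_norm]
  exact hΓ.infDist_le hs q y x

theorem norm_le_add (hΓ : IsLipschitzMultifunction Γ γ₀ γ₁) {s : ℝ} (hs : 0 ≤ s) {x y : E}
    (hy : y ∈ Γ s x) : ‖y‖ ≤ γ₀ s + γ₁ s * ‖x‖ := by
  obtain ⟨y', hy', h⟩ := hΓ.exists_norm_sub_le s hs x 0 y hy
  rw [sub_zero] at h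
  have h1 := hΓ.norm_le s hs y' hy'
  have h2 := norm_le_norm_add_norm_sub' y y'
  linarith

theorem integral_γ₀_mono (hΓ : IsLipschitzMultifunction Γ γ₀ γ₁) {a b c d : ℝ} (h1 : c ≤ a)
    (h : a ≤ b) (h2 : b ≤ d) : ∫ τ in a..b, γ₀ τ ≤ ∫ τ in c..d, γ₀ τ :=
  intervalIntegral.integral_mono_interval h1 h h2 (Eventually.of_forall hΓ.γ₀_nonneg)
    (hΓ.γ₀_locallyIntegrable.intervalIntegrable_real c d)

theorem integral_γ₁_mono (hΓ : IsLipschitzMultifunction Γ γ₀ γ₁) {a b c d : ℝ} (h1 : c ≤ a)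
    (h : a ≤ b) (h2 : b ≤ d) : ∫ τ in a..b, γ₁ τ ≤ ∫ τ in c..d, γ₁ τ :=
  intervalIntegral.integral_mono_interval h1 h h2 (Eventually.of_forall hΓ.γ₁_nonneg)
    (hΓ.γ₁_locallyIntegrable.intervalIntegrable_real c d)

/-- Being only close to `Γ` is an open condition, so values may be taken in a countable dense set,
and measurability reduces to choosing an index measurably. This avoids an exact measurable selection
theorem. -/
theorem exists_approx_selection [TopologicalSpace.SeparableSpace E]
    (hΓ : IsLipschitzMultifunction Γ γ₀ γ₁) {t : ℝ} (ht : 0 ≤ t) {x x' f : ℝ → E} {ε ε' : ℝ → ℝ}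
    (hx : AEStronglyMeasurable x (volume.restrict (Ici t)))
    (hx' : AEStronglyMeasurable x' (volume.restrict (Ici t)))
    (hf : AEStronglyMeasurable f (volume.restrict (Ici t)))
    (hε : Measurable ε) (hε' : Measurable ε') (hε'0 : ∀ s, 0 < ε' s)
    (h : ∀ᵐ s ∂(volume.restrict (Ici t)), Metric.infDist (f s) (Γ s (x s)) < ε s) :
    ∃ f' : ℝ → E, AEStronglyMeasurable f' (volume.restrict (Ici t)) ∧
      ∀ᵐ s ∂(volume.restrict (Ici t)), Metric.infDist (f' s) (Γ s (x' s)) < ε' s ∧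
        ‖f' s - f s‖ ≤ γ₁ s * ‖x s - x' s‖ + ε s := by
  set μ := volume.restrict (Ici t)
  set q := TopologicalSpace.denseSeq E
  have hmem : ∀ᵐ s ∂μ, 0 ≤ s :=
    (ae_restrict_mem measurableSet_Ici).mono fun s hs => ht.trans hs
  set A : ℕ → Set ℝ := fun m => {s | Metric.infDist (q m) (Γ s (x' s)) < ε' s} ∩
    {s | ‖q m - f s‖ < γ₁ s * ‖x s - x' s‖ + ε s} with hAdef
  have hA : ∀ m, NullMeasurableSet (A m) μ := by
    intro m
    refine (nullMeasurableSet_lt ?_ hε'.aemeasurable).inter (nullMeasurableSet_lt ?_ ?_)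
    · refine aemeasurable_caratheodory (G := fun s x => Metric.infDist (q m) (Γ s x)) ?_ ?_ hx'
      · exact fun y => (hΓ.aemeasurable_infDist y (q m)).mono_measure
          (Measure.restrict_mono (Ici_subset_Ici.2 ht) le_rfl)
      · exact hmem.mono fun s hs => hΓ.continuous_infDist hs (q m)
    · exact (aestronglyMeasurable_const.sub hf).norm.aemeasurable
    · exact (hΓ.γ₁_locallyIntegrable.aestronglyMeasurable.aemeasurable.restrict.mul
        (hx.sub hx').norm.aemeasurable).add hε.aemeasurable
  have hcov : ∀ᵐ s ∂μ, ∃ m, s ∈ A m := by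
    filter_upwards [hmem, h] with s hs hsε
    obtain ⟨w, hw, hfw⟩ := (Metric.infDist_lt_iff (hΓ.nonempty s hs _)).1 hsε
    obtain ⟨w', hw', hww'⟩ := hΓ.exists_norm_sub_le s hs (x s) (x' s) w hw
    -- Being within `ε' s` of `w'` gives the new tolerance; the slack left in the strict inequality
    -- `dist (f s) w < ε s` pays for replacing `w'` by a dense point.
    set r := min (ε' s) (ε s - dist (f s) w)
    obtain ⟨m, hm⟩ := (TopologicalSpace.denseRange_denseSeq E).exists_dist_lt w'
      (show 0 < r from lt_min (hε'0 s) (sub_pos.2 hfw))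
    refine ⟨m, ?_, ?_⟩
    · refine (Metric.infDist_le_dist_of_mem hw').trans_lt ?_
      rw [dist_comm]
      exact hm.trans_le (min_le_left _ _)
    · have h1 : dist w' (q m) < ε s - dist (f s) w := hm.trans_le (min_le_right _ _)
      have h2 := dist_triangle4 (f s) w w' (q m)
      rw [dist_eq_norm w w'] at h2
      change ‖q m - f s‖ < _
      rw [← dist_eq_norm, dist_comm]
      linarith
  obtain ⟨N, hN, hNA⟩ := exists_measurable_index hA hcov
  refine ⟨fun s => q (N s), ?_, ?_⟩
  · exact ((StronglyMeasurable.of_discrete (f := q)).comp_measurable hN).aestronglyMeasurable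
  · filter_upwards [hNA] with s hs
    exact ⟨hs.1, le_of_lt hs.2⟩

end IsLipschitzMultifunction

theorem locallyIntegrable_indicator_of_norm_sub_le {t : ℝ} {f g : ℝ → E} {b : ℝ → ℝ}
    (hf : LocallyIntegrable f volume) (hb : LocallyIntegrable b volume)
    (hg : AEStronglyMeasurable g (volume.restrict (Ici t)))
    (h : ∀ᵐ s ∂(volume.restrict (Ici t)), ‖g s - f s‖ ≤ b s) :
    LocallyIntegrable ((Ici t).indicator g) volume := by
  have hfb : LocallyIntegrable (fun s => ‖f s‖ + b s) volume := by
    refine LocallyIntegrable.add ?_ hb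
    exact hf.mono hf.aestronglyMeasurable.norm (by simp)
  refine hfb.mono ((aestronglyMeasurable_indicator_iff measurableSet_Ici).2 hg) ?_
  rw [ae_restrict_iff' measurableSet_Ici] at h
  filter_upwards [h] with s hs
  by_cases hst : s ∈ Ici t
  · have h1 := hs hst
    have h2 := norm_le_norm_add_norm_sub' (g s) (f s)
    rw [indicator_of_mem hst]
    exact (by linarith : ‖g s‖ ≤ ‖f s‖ + b s).trans (le_abs_self _)
  · rw [indicator_of_notMem hst]
    simp

theorem sum_geometric_half_le (N : ℕ) : ∑ n ∈ Finset.range N, (1 / 2 : ℝ) ^ (n + 1) ≤ 1 := by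
  have : ∑ n ∈ Finset.range N, (1 / 2 : ℝ) ^ (n + 1) = 1 - (1 / 2) ^ N := by
    induction N with
    | zero => simp
    | succ N ih => rw [Finset.sum_range_succ, ih]; ring
  rw [this]
  have : (0 : ℝ) ≤ (1 / 2) ^ N := by positivity
  linarith

variable [NormedSpace ℝ E]

/-- Consecutive Picard-type iterates of a differential inclusion: exponential bound on the sum of
the increments. -/
theorem sum_norm_sub_le_exp {γ : ℝ → ℝ} (hγ : LocallyIntegrable γ volume) (hγ0 : ∀ s, 0 ≤ γ s)
    {t η δ : ℝ} (ht : 0 ≤ t) (hη : 0 ≤ η) (hδ : 0 ≤ δ) {x f : ℕ → ℝ → E}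
    (hx : ∀ n, Continuous (x n)) (hf : ∀ n, LocallyIntegrable (f n) volume)
    (h0 : ∀ s, ‖x 0 s - x 1 s‖ = δ)
    (hsub : ∀ n s, x (n + 1) s - x (n + 2) s = ∫ τ in t..s, (f n τ - f (n + 1) τ))
    (hstep : ∀ n, ∀ᵐ s ∂(volume.restrict (Ici t)), ‖f n s - f (n + 1) s‖ ≤
      γ s * ‖x n s - x (n + 1) s‖ + η * (1 / 2) ^ (n + 1) * Real.exp (-s))
    (N : ℕ) : ∀ s, t ≤ s → ∑ n ∈ Finset.range N, ‖x n s - x (n + 1) s‖ ≤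
      (δ + η) * Real.exp (∫ τ in t..s, γ τ) := by
  induction N with
  | zero => intro s _; simp; positivity
  | succ N ih =>
    intro s hs
    have hγi := hγ.intervalIntegrable_real t s
    have hint1 : ∀ n, IntervalIntegrable (fun τ => γ τ * ‖x n τ - x (n + 1) τ‖) volume t s :=
      fun n => hγi.mul_continuousOn ((hx n).sub (hx (n + 1))).norm.continuousOn
    have hcexp : ∀ c : ℝ, Continuous fun τ : ℝ => c * Real.exp (-τ) := fun c => by fun_prop
    have hint2 : ∀ c : ℝ, IntervalIntegrable (fun τ => c * Real.exp (-τ)) volume t s :=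
      fun c => (hcexp c).intervalIntegrable _ _
    have hcm : Continuous fun τ => (δ + η) * Real.exp (∫ σ in t..τ, γ σ) :=
      continuous_const.mul (hγ.continuous_integral t).rexp
    have hD : ∀ n, ‖x (n + 1) s - x (n + 2) s‖ ≤ ∫ τ in t..s,
        (γ τ * ‖x n τ - x (n + 1) τ‖ + η * (1 / 2) ^ (n + 1) * Real.exp (-τ)) := by
      intro n
      rw [hsub]
      refine (intervalIntegral.norm_integral_le_integral_norm hs).trans ?_
      refine intervalIntegral.integral_mono_ae_restrict hs ?_ ((hint1 n).add (hint2 _)) ?_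
      · exact (((hf n).sub (hf (n + 1))).intervalIntegrable_real t s).norm
      · exact ae_mono (Measure.restrict_mono Icc_subset_Ici_self le_rfl) (hstep n)
    have hexp : ∫ τ in t..s, Real.exp (-τ) ≤ 1 := by
      have h1 : ∫ τ in t..s, Real.exp (-τ) = Real.exp (-t) - Real.exp (-s) := by
        rw [intervalIntegral.integral_comp_neg (fun τ => Real.exp τ), integral_exp]
      rw [h1]
      have h2 := Real.exp_pos (-s)
      have h3 : Real.exp (-t) ≤ 1 := Real.exp_le_one_iff.2 (by linarith)
      linarith
    rw [Finset.sum_range_succ', h0]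
    -- Integrating the step estimates and inserting the induction hypothesis gives δ + (δ +
    -- η)(exp(∫γ) - 1) + η, which is exactly the claimed bound. The errors add up to at most η since
    -- Σ 2^-(n+1) ≤ 1 and, as t ≥ 0, ∫ exp(-τ) ≤ 1.
    have h1 : ∑ n ∈ Finset.range N, ‖x (n + 1) s - x (n + 2) s‖ ≤ ∫ τ in t..s,
        ((δ + η) * (γ τ * Real.exp (∫ σ in t..τ, γ σ)) + η * Real.exp (-τ)) := by
      refine (Finset.sum_le_sum fun n _ => hD n).trans ?_
      rw [← intervalIntegral.integral_finsetSum fun n _ => (hint1 n).add (hint2 _)]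
      refine intervalIntegral.integral_mono_on hs ?_ ?_ ?_
      · have := IntervalIntegrable.sum (Finset.range N) fun n _ =>
          (hint1 n).add (hint2 (η * (1 / 2) ^ (n + 1)))
        rwa [Finset.sum_fn] at this
      · refine IntervalIntegrable.add ?_ (hint2 η)
        exact (hγi.mul_continuousOn (hγ.continuous_integral t).rexp.continuousOn).const_mul _
      · intro τ hτ
        rw [Finset.sum_add_distrib, ← Finset.mul_sum, ← Finset.sum_mul, ← Finset.mul_sum]
        have h2 := mul_le_mul_of_nonneg_left (ih τ hτ.1) (hγ0 τ)
        have h3 := mul_le_mul_of_nonneg_left (sum_geometric_half_le N) hη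
        have h4 := mul_le_mul_of_nonneg_right h3 (Real.exp_pos (-τ)).le
        linarith
    have h5 := integral_mul_exp_integral_le hγ hγ0 hs
    rw [intervalIntegral.integral_add, intervalIntegral.integral_const_mul,
      intervalIntegral.integral_const_mul] at h1
    · have h6 := mul_le_mul_of_nonneg_left h5 (add_nonneg hδ hη)
      have h7 := mul_le_mul_of_nonneg_left hexp hη
      linarith
    · exact (hγi.mul_continuousOn (hγ.continuous_integral t).rexp.continuousOn).const_mul _
    · exact hint2 η

end Filippov

/-! ### Filippov's theorem on a half-line -/

section Filippov

variable {E : Type*} [NormedAddCommGroup E] [NormedSpace ℝ E] {Γ : ℝ → E → Set E} {γ₀ γ₁ : ℝ → ℝ}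

/-- Each state is the primitive from ξ' of the previous velocity, and each new velocity is an
approximate selection along that state, close to the previous one. The tolerances are summable in n
and integrable in s. -/
theorem exists_approx_trajectory_sequence [TopologicalSpace.SeparableSpace E]
    (hΓ : IsLipschitzMultifunction Γ γ₀ γ₁) {t : ℝ} (ht : 0 ≤ t) {f₀ : ℝ → E}
    (hf₀ : LocallyIntegrable f₀ volume) {ξ ξ' : E}
    (hadm : ∀ᵐ s ∂(volume.restrict (Ici t)), f₀ s ∈ Γ s (ξ + ∫ τ in t..s, f₀ τ))
    {η : ℝ} (hη : 0 < η) :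
    ∃ x f : ℕ → ℝ → E, (x 0 = fun s => ξ + ∫ τ in t..s, f₀ τ) ∧ f 0 = f₀ ∧
      (∀ n, x (n + 1) = fun s => ξ' + ∫ τ in t..s, f n τ) ∧
      (∀ n, LocallyIntegrable (f n) volume) ∧
      (∀ n, ∀ᵐ s ∂(volume.restrict (Ici t)), Metric.infDist (f n s) (Γ s (x n s)) <
        η * (1 / 2) ^ (n + 1) * Real.exp (-s)) ∧
      ∀ n, ∀ᵐ s ∂(volume.restrict (Ici t)), ‖f n s - f (n + 1) s‖ ≤
        γ₁ s * ‖x n s - x (n + 1) s‖ + η * (1 / 2) ^ (n + 1) * Real.exp (-s) := by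
  set μ := volume.restrict (Ici t)
  set ε : ℕ → ℝ → ℝ := fun n s => η * (1 / 2) ^ (n + 1) * Real.exp (-s) with hε
  have hεc : ∀ n, Continuous (ε n) := fun n => by simp only [hε]; fun_prop
  have hε0 : ∀ n s, 0 < ε n s := fun n s => by simp only [hε]; positivity
  let X : (ℝ → E) → ℝ → E := fun f s => ξ' + ∫ τ in t..s, f τ
  have hXc : ∀ {f : ℝ → E}, LocallyIntegrable f volume → Continuous (X f) :=
    fun hf => continuous_const.add (hf.continuous_integral t)
  let Good : ℕ → (ℝ → E) → (ℝ → E) → Prop := fun n x f => Continuous x ∧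
    LocallyIntegrable f volume ∧ ∀ᵐ s ∂μ, Metric.infDist (f s) (Γ s (x s)) < ε n s
  have step : ∀ n x f, Good n x f → ∃ f', Good (n + 1) (X f) f' ∧
      ∀ᵐ s ∂μ, ‖f s - f' s‖ ≤ γ₁ s * ‖x s - X f s‖ + ε n s := by
    rintro n x f ⟨hx, hf, hd⟩
    obtain ⟨f', hf'm, hf'⟩ := hΓ.exists_approx_selection ht hx.aestronglyMeasurable
      (hXc hf).aestronglyMeasurable hf.aestronglyMeasurable.restrict (hεc n).measurable
      (hεc (n + 1)).measurable (hε0 (n + 1)) hd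
    have hmem : ∀ᵐ s ∂μ, s ∈ Ici t := ae_restrict_mem measurableSet_Ici
    -- The selection is controlled only on [t, ∞); cutting it off makes it locally integrable on the
    -- whole line.
    refine ⟨(Ici t).indicator f', ⟨hXc hf, ?_, ?_⟩, ?_⟩
    · refine locallyIntegrable_indicator_of_norm_sub_le hf
        (b := fun s => γ₁ s * ‖x s - X f s‖ + ε n s) ?_ hf'm (hf'.mono fun s hs => hs.2)
      exact (hΓ.γ₁_locallyIntegrable.mul_continuous (hx.sub (hXc hf)).norm).add
        (hεc n).locallyIntegrable
    · filter_upwards [hmem, hf'] with s hs h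
      rw [indicator_of_mem hs]
      exact h.1
    · filter_upwards [hmem, hf'] with s hs h
      rw [indicator_of_mem hs, norm_sub_rev]
      exact h.2
  choose! F hF using step
  let p : ℕ → (ℝ → E) × (ℝ → E) := fun n =>
    Nat.rec (fun s => ξ + ∫ τ in t..s, f₀ τ, f₀) (fun n p => (X p.2, F n p.1 p.2)) n
  have hp : ∀ n, Good n (p n).1 (p n).2 := by
    intro n
    induction n with
    | zero =>
      refine ⟨continuous_const.add (hf₀.continuous_integral t), hf₀, ?_⟩
      filter_upwards [hadm] with s hs
      exact (Metric.infDist_zero_of_mem hs).trans_lt (hε0 0 s)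
    | succ n ih => exact (hF n _ _ ih).1
  exact ⟨fun n => (p n).1, fun n => (p n).2, rfl, rfl, fun n => rfl, fun n => (hp n).2.1,
    fun n => (hp n).2.2, fun n => (hF n _ _ (hp n)).2⟩

/-- Filippov's theorem on a half-line: a trajectory starting from `ξ` can be followed by a
trajectory starting from `ξ'`. -/
theorem exists_neighboring_trajectory [CompleteSpace E] [TopologicalSpace.SeparableSpace E]
    (hΓ : IsLipschitzMultifunction Γ γ₀ γ₁) {t : ℝ} (ht : 0 ≤ t) {f₀ : ℝ → E}
    (hf₀ : LocallyIntegrable f₀ volume) {ξ ξ' : E}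
    (hadm : ∀ᵐ s ∂(volume.restrict (Ici t)), f₀ s ∈ Γ s (ξ + ∫ τ in t..s, f₀ τ))
    {η : ℝ} (hη : 0 < η) :
    ∃ g : ℝ → E, LocallyIntegrable g volume ∧
      (∀ᵐ s ∂(volume.restrict (Ici t)), g s ∈ Γ s (ξ' + ∫ τ in t..s, g τ)) ∧
      (∀ᵐ s ∂(volume.restrict (Ici t)), ‖g s - f₀ s‖ ≤
        γ₁ s * ((‖ξ - ξ'‖ + η) * Real.exp (∫ τ in t..s, γ₁ τ)) + η * Real.exp (-s)) ∧
      ∀ s, t ≤ s → ‖(ξ' + ∫ τ in t..s, g τ) - (ξ + ∫ τ in t..s, f₀ τ)‖ ≤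
        (‖ξ - ξ'‖ + η) * Real.exp (∫ τ in t..s, γ₁ τ) := by
  obtain ⟨x, f, hx0, hf0, hxs, hfi, hdist, hstep⟩ :=
    exists_approx_trajectory_sequence hΓ ht hf₀ (ξ' := ξ') hadm hη
  set μ := volume.restrict (Ici t)
  set R : ℝ → ℝ := fun s => (‖ξ - ξ'‖ + η) * Real.exp (∫ τ in t..s, γ₁ τ) with hR
  set b : ℝ → ℝ := fun s => γ₁ s * R s + η * Real.exp (-s) with hb
  have hmem : ∀ᵐ s ∂μ, s ∈ Ici t := ae_restrict_mem measurableSet_Ici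
  have hRc : Continuous R :=
    continuous_const.mul (hΓ.γ₁_locallyIntegrable.continuous_integral t).rexp
  have hbi : LocallyIntegrable b volume :=
    (hΓ.γ₁_locallyIntegrable.mul_continuous hRc).add
      (by fun_prop : Continuous fun s : ℝ => η * Real.exp (-s)).locallyIntegrable
  have hxc : ∀ n, Continuous (x n) := by
    rintro (_ | n)
    · rw [hx0]; exact continuous_const.add (hf₀.continuous_integral t)
    · rw [hxs]; exact continuous_const.add ((hfi n).continuous_integral t)
  have hsum := sum_norm_sub_le_exp hΓ.γ₁_locallyIntegrable hΓ.γ₁_nonneg ht hη.le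
    (norm_nonneg (ξ - ξ')) hxc hfi (fun s => by rw [hxs, hx0, hf0]; simp)
    (fun n s => by
      rw [hxs, hxs, intervalIntegral.integral_sub ((hfi n).intervalIntegrable_real _ _)
        ((hfi (n + 1)).intervalIntegrable_real _ _)]
      simp) hstep
  have hstep' : ∀ᵐ s ∂μ, ∀ n, ‖f n s - f (n + 1) s‖ ≤
      γ₁ s * ‖x n s - x (n + 1) s‖ + η * (1 / 2) ^ (n + 1) * Real.exp (-s) := ae_all_iff.2 hstep
  -- This one bound makes the velocities converge almost everywhere, dominates them for passing to
  -- the limit under the integral, and gives the final velocity estimate.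
  have hfsum : ∀ᵐ s ∂μ, ∀ N, ∑ n ∈ Finset.range N, ‖f n s - f (n + 1) s‖ ≤ b s := by
    filter_upwards [hmem, hstep'] with s hs h N
    refine (Finset.sum_le_sum fun n _ => h n).trans ?_
    rw [Finset.sum_add_distrib, ← Finset.mul_sum, ← Finset.sum_mul, ← Finset.mul_sum]
    have h2 := mul_le_mul_of_nonneg_left (hsum N s hs) (hΓ.γ₁_nonneg s)
    have h3 := mul_le_mul_of_nonneg_left (sum_geometric_half_le N) hη.le
    have h4 := mul_le_mul_of_nonneg_right h3 (Real.exp_pos (-s)).le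
    simp only [hb, hR]
    linarith
  have hflim : ∀ᵐ s ∂μ, ∃ l, Tendsto (fun n => f n s) atTop (𝓝 l) := by
    filter_upwards [hfsum] with s hs
    refine cauchySeq_tendsto_of_complete (cauchySeq_of_summable_dist ?_)
    refine summable_of_sum_range_le (c := b s) (fun _ => dist_nonneg) fun N => ?_
    simpa only [dist_eq_norm] using hs N
  obtain ⟨g, hgm, hg⟩ := exists_stronglyMeasurable_limit_of_tendsto_ae
    (fun n => (hfi n).aestronglyMeasurable.restrict) hflim
  have hfn : ∀ᵐ s ∂μ, ∀ n, ‖f n s - f₀ s‖ ≤ b s := by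
    filter_upwards [hfsum] with s hs n
    have h1 := dist_le_range_sum_dist (fun n => f n s) n
    simp only [hf0, dist_eq_norm] at h1
    rw [norm_sub_rev]
    exact h1.trans (hs n)
  have hgb : ∀ᵐ s ∂μ, ‖g s - f₀ s‖ ≤ b s := by
    filter_upwards [hg, hfn] with s hs h
    exact le_of_tendsto (hs.sub_const _).norm (Eventually.of_forall h)
  have hGi : LocallyIntegrable ((Ici t).indicator g) volume :=
    locallyIntegrable_indicator_of_norm_sub_le hf₀ hbi hgm.aestronglyMeasurable hgb
  have hlim : ∀ s, t ≤ s → Tendsto (fun n => x n s) atTop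
      (𝓝 (ξ' + ∫ τ in t..s, (Ici t).indicator g τ)) := by
    intro s hs
    -- The shift discards `x 0`, the only state that starts from ξ.
    rw [← tendsto_add_atTop_iff_nat 1]
    simp only [hxs]
    refine tendsto_const_nhds.add ?_
    have hae : ∀ {P : ℝ → Prop}, (∀ᵐ τ ∂μ, P τ) → ∀ᵐ τ, τ ∈ uIoc t s → P τ := by
      intro P hP
      rw [ae_restrict_iff' measurableSet_Ici] at hP
      filter_upwards [hP] with τ h hτ
      rw [uIoc_of_le hs] at hτ
      exact h hτ.1.le
    refine intervalIntegral.tendsto_integral_filter_of_dominated_convergence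
      (fun τ => ‖f₀ τ‖ + b τ) ?_ ?_ ?_ ?_
    · exact Eventually.of_forall fun n => (hfi n).aestronglyMeasurable.restrict
    · refine Eventually.of_forall fun n => hae ?_
      filter_upwards [hfn] with τ h
      have h2 := norm_le_norm_add_norm_sub' (f n τ) (f₀ τ)
      linarith [h n]
    · exact (hf₀.intervalIntegrable_real t s).norm.add (hbi.intervalIntegrable_real t s)
    · refine hae ?_
      filter_upwards [hg, hmem] with τ h hτ
      rwa [indicator_of_mem hτ]
  refine ⟨(Ici t).indicator g, hGi, ?_, ?_, ?_⟩
  · have hdist' := ae_all_iff.2 hdist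
    filter_upwards [hmem, hg, hdist'] with s hs hgs hds
    have hs0 : 0 ≤ s := ht.trans hs
    rw [indicator_of_mem hs]
    set y := ξ' + ∫ τ in t..s, (Ici t).indicator g τ
    rw [(hΓ.isClosed s hs0 y).mem_iff_infDist_zero (hΓ.nonempty s hs0 y)]
    refine le_antisymm ?_ Metric.infDist_nonneg
    -- The three errors are the tolerance, the motion of the set from `x n s` to `y`, and the
    -- velocity error; all vanish, and closedness of the values yields membership.
    have hle : ∀ n, Metric.infDist (g s) (Γ s y) ≤
        η * (1 / 2) ^ (n + 1) * Real.exp (-s) + γ₁ s * ‖x n s - y‖ + ‖g s - f n s‖ := by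
      intro n
      have h1 := hΓ.infDist_le hs0 (f n s) (x n s) y
      have h2 := Metric.infDist_le_infDist_add_dist (s := Γ s y) (x := g s) (y := f n s)
      rw [dist_eq_norm] at h2
      linarith [hds n]
    have hl1 : Tendsto (fun n => η * (1 / 2 : ℝ) ^ (n + 1) * Real.exp (-s)) atTop (𝓝 0) := by
      have := (tendsto_pow_atTop_nhds_zero_of_lt_one (r := (1 / 2 : ℝ)) (by norm_num)
        (by norm_num)).comp (tendsto_add_atTop_nat 1)
      simpa using (this.const_mul η).mul_const (Real.exp (-s))
    have hl2 : Tendsto (fun n => γ₁ s * ‖x n s - y‖) atTop (𝓝 0) := by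
      have h : Tendsto (fun n => x n s) atTop (𝓝 y) := hlim s hs
      simpa using (h.sub_const y).norm.const_mul (γ₁ s)
    have hl3 : Tendsto (fun n => ‖g s - f n s‖) atTop (𝓝 0) := by
      simpa using (hgs.const_sub (g s)).norm
    exact ge_of_tendsto' (by simpa using (hl1.add hl2).add hl3) hle
  · filter_upwards [hmem, hgb] with s hs h
    rw [indicator_of_mem hs]
    exact h
  · intro s hs
    have h1 : ∀ n, ‖x n s - x 0 s‖ ≤ R s := by
      intro n
      have h1 := dist_le_range_sum_dist (fun n => x n s) n
      simp only [dist_eq_norm] at h1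
      rw [norm_sub_rev]
      exact h1.trans (hsum n s hs)
    have h2 := le_of_tendsto ((hlim s hs).sub_const (x 0 s)).norm (Eventually.of_forall h1)
    rwa [hx0] at h2

end Filippov

/-! ### Admissible trajectories: concatenation, neighbors, growth -/

section Trajectories

variable {E : Type*} [NormedAddCommGroup E] [NormedSpace ℝ E] {Γ : ℝ → E → Set E} {γ₀ γ₁ : ℝ → ℝ}

theorem ae_restrict_Ici_mono {P : ℝ → Prop} {t t' : ℝ} (h : t ≤ t')
    (hP : ∀ᵐ s ∂(volume.restrict (Ici t)), P s) : ∀ᵐ s ∂(volume.restrict (Ici t')), P s :=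
  ae_mono (Measure.restrict_mono (Ici_subset_Ici.2 h) le_rfl) hP

theorem admissible_restrict {t t' : ℝ} {ξ : E} {x : ℝ → E} (h : t ≤ t')
    (hx : x ∈ admissible Γ t ξ) : x ∈ admissible Γ t' (x t') :=
  ⟨hx.1, ae_restrict_Ici_mono h hx.2.1, rfl⟩

/-- Gluing the velocities and integrating from t' yields an arc at once; the primitive agrees with
each piece on its own side of t'. -/
theorem admissible_concat [CompleteSpace E] {t t' : ℝ} (ht : 0 ≤ t) (h : t ≤ t') {ξ : E}
    {x₀ x₁ : ℝ → E} (hx₀ : x₀ ∈ admissible Γ t ξ) (hx₁ : x₁ ∈ admissible Γ t' (x₀ t')) :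
    ∃ y ∈ admissible Γ t ξ,
      (∀ᵐ s, s ∈ Ioc t t' → y s = x₀ s ∧ deriv y s = deriv x₀ s) ∧
      (∀ᵐ s, s ∈ Ioi t' → y s = x₁ s ∧ deriv y s = deriv x₁ s) := by
  set G₀ := (Ici 0).indicator (deriv x₀) with hG₀
  set G₁ := (Ici 0).indicator (deriv x₁) with hG₁
  set g : ℝ → E := (Iio t').indicator G₀ + (Ici t').indicator G₁ with hgdef
  have ht' : 0 ≤ t' := ht.trans h
  have hg : LocallyIntegrable g volume :=
    ((locallyIntegrable_indicator_of_locallyIntegrableOn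
      hx₀.1.locallyIntegrable_deriv).indicator measurableSet_Iio).add
    ((locallyIntegrable_indicator_of_locallyIntegrableOn
      hx₁.1.locallyIntegrable_deriv).indicator measurableSet_Ici)
  have hg0 : ∀ s, 0 ≤ s → s < t' → g s = deriv x₀ s := fun s h0 hs => by
    simp [hgdef, hG₀, hs, h0, not_le.2 hs]
  have hg1 : ∀ s, t' ≤ s → g s = deriv x₁ s := fun s hs => by
    simp [hgdef, hG₁, hs, ht'.trans hs, not_lt.2 hs]
  set y : ℝ → E := fun s => x₀ t' + ∫ τ in t'..s, g τ with hy
  have hy0 : ∀ s, 0 ≤ s → s ≤ t' → y s = x₀ s := by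
    intro s h0 hs
    rw [hx₀.1.eq_add_integral ht' h0]
    simp only [hy]
    congr 1
    refine intervalIntegral.integral_congr_ae ?_
    filter_upwards [compl_mem_ae_iff.2 (measure_singleton t')] with τ hτ hτ'
    rw [uIoc_of_ge hs] at hτ'
    have h0τ : 0 ≤ τ := h0.trans hτ'.1.le
    rw [hg0 τ h0τ (lt_of_le_of_ne hτ'.2 hτ), indicator_of_mem (show τ ∈ Ici 0 from h0τ)]
  have hy1 : ∀ s, t' ≤ s → y s = x₁ s := by
    intro s hs
    rw [hx₁.1.eq_add_integral ht' (ht'.trans hs), hx₁.2.2]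
    simp only [hy]
    congr 1
    refine intervalIntegral.integral_congr fun τ hτ => ?_
    rw [uIcc_of_le hs] at hτ
    rw [hg1 τ hτ.1, indicator_of_mem (show τ ∈ Ici 0 from ht'.trans hτ.1)]
  have hd := deriv_primitive_ae_eq hg t' (x₀ t')
  refine ⟨y, ⟨isArc_primitive hg t' (x₀ t'), ?_, by rw [hy0 t ht h, hx₀.2.2]⟩, ?_, ?_⟩
  · have h0 := hx₀.2.1
    have h1 := hx₁.2.1
    rw [ae_restrict_iff' measurableSet_Ici] at h0 h1 ⊢
    filter_upwards [h0, h1, hd] with s h0 h1 hd hs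
    rw [hd]
    rcases lt_or_ge s t' with h' | h'
    · rw [hg0 s (ht.trans hs) h', hy0 s (ht.trans hs) h'.le]
      exact h0 hs
    · rw [hg1 s h', hy1 s h']
      exact h1 h'
  · filter_upwards [hd, compl_mem_ae_iff.2 (measure_singleton t')] with s hd hne hs
    refine ⟨hy0 s (ht.trans hs.1.le) hs.2, ?_⟩
    rw [hd, hg0 s (ht.trans hs.1.le) (lt_of_le_of_ne hs.2 hne)]
  · filter_upwards [hd] with s hd hs
    exact ⟨hy1 s (le_of_lt hs), by rw [hd, hg1 s (le_of_lt hs)]⟩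

namespace IsLipschitzMultifunction

theorem exists_neighboring_admissible [CompleteSpace E] [TopologicalSpace.SeparableSpace E]
    (hΓ : IsLipschitzMultifunction Γ γ₀ γ₁) {t : ℝ} (ht : 0 ≤ t) {ξ : E} (ξ' : E) {x : ℝ → E}
    (hx : x ∈ admissible Γ t ξ) {η : ℝ} (hη : 0 < η) :
    ∃ x' ∈ admissible Γ t ξ',
      (∀ s, t ≤ s → ‖x' s - x s‖ ≤ (‖ξ - ξ'‖ + η) * Real.exp (∫ τ in t..s, γ₁ τ)) ∧
      ∀ᵐ s ∂(volume.restrict (Ici t)), ‖deriv x' s - deriv x s‖ ≤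
        γ₁ s * ((‖ξ - ξ'‖ + η) * Real.exp (∫ τ in t..s, γ₁ τ)) + η * Real.exp (-s) := by
  have hf₀ := locallyIntegrable_indicator_of_locallyIntegrableOn hx.1.locallyIntegrable_deriv
  have hxs : ∀ s, t ≤ s → x s = ξ + ∫ τ in t..s, (Ici 0).indicator (deriv x) τ := by
    intro s hs
    rw [hx.1.eq_add_integral ht (ht.trans hs), hx.2.2]
  have hmem : ∀ᵐ s ∂(volume.restrict (Ici t)), s ∈ Ici t := ae_restrict_mem measurableSet_Ici
  have hind : ∀ s ∈ Ici t, (Ici 0).indicator (deriv x) s = deriv x s := fun s hs =>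
    indicator_of_mem (show s ∈ Ici 0 from ht.trans hs) _
  obtain ⟨g, hg, hgΓ, hgd, hgx⟩ := exists_neighboring_trajectory hΓ ht hf₀ (ξ := ξ) (ξ' := ξ')
    (by
      filter_upwards [hmem, hx.2.1] with s hs h
      rwa [← hxs s hs, hind s hs]) hη
  have hd := ae_restrict_of_ae (s := Ici t) (deriv_primitive_ae_eq hg t ξ')
  refine ⟨fun s => ξ' + ∫ τ in t..s, g τ, ⟨isArc_primitive hg t ξ', ?_, by simp⟩, ?_, ?_⟩
  · filter_upwards [hd, hgΓ] with s hd h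
    rwa [hd]
  · intro s hs
    rw [hxs s hs]
    exact hgx s hs
  · filter_upwards [hd, hgd, hmem] with s hd h hs
    rwa [hd, ← hind s hs]

theorem ae_norm_deriv_le (hΓ : IsLipschitzMultifunction Γ γ₀ γ₁) {t : ℝ} (ht : 0 ≤ t) {ξ : E}
    {x : ℝ → E} (hx : x ∈ admissible Γ t ξ) :
    ∀ᵐ s ∂(volume.restrict (Ici t)), ‖deriv x s‖ ≤ γ₀ s + γ₁ s * ‖x s‖ := by
  filter_upwards [hx.2.1, ae_restrict_mem measurableSet_Ici] with s h hs
  exact hΓ.norm_le_add (ht.trans hs) h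

theorem norm_le_growth (hΓ : IsLipschitzMultifunction Γ γ₀ γ₁) {t : ℝ} (ht : 0 ≤ t) {ξ : E}
    {x : ℝ → E} (hx : x ∈ admissible Γ t ξ) {s : ℝ} (hs : t ≤ s) :
    ‖x s‖ ≤ (‖ξ‖ + 1) * (Real.exp (∫ τ in (0 : ℝ)..s, γ₁ τ) * (1 + ∫ τ in (0 : ℝ)..s, γ₀ τ)) := by
  have hf₀ := locallyIntegrable_indicator_of_locallyIntegrableOn hx.1.locallyIntegrable_deriv
  have hxc : ContinuousOn x (Ici t) := hx.1.continuousOn.mono (Ici_subset_Ici.2 ht)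
  have hγ₀i := hΓ.γ₀_locallyIntegrable.intervalIntegrable_real
  set A := ‖ξ‖ + ∫ τ in t..s, γ₀ τ with hA
  have hI0 : 0 ≤ ∫ τ in t..s, γ₀ τ :=
    intervalIntegral.integral_nonneg hs fun u _ => hΓ.γ₀_nonneg u
  have hA0 : 0 ≤ A := add_nonneg (norm_nonneg _) hI0
  have hbound : ∀ r ∈ Icc t s, ‖x r‖ ≤ A + ∫ τ in t..r, γ₁ τ * ‖x τ‖ := by
    intro r hr
    have hi2 : IntervalIntegrable (fun τ => γ₁ τ * ‖x τ‖) volume t r := by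
      refine (hΓ.γ₁_locallyIntegrable.intervalIntegrable_real t r).mul_continuousOn ?_
      rw [uIcc_of_le hr.1]
      exact (hxc.mono Icc_subset_Ici_self).norm
    have h1 : ‖∫ τ in t..r, (Ici 0).indicator (deriv x) τ‖ ≤
        ∫ τ in t..r, (γ₀ τ + γ₁ τ * ‖x τ‖) := by
      refine (intervalIntegral.norm_integral_le_integral_norm hr.1).trans ?_
      refine intervalIntegral.integral_mono_ae_restrict hr.1
        (hf₀.intervalIntegrable_real t r).norm ((hγ₀i t r).add hi2) ?_
      refine ae_restrict_of_ae_restrict_of_subset (t := Ici t) Icc_subset_Ici_self ?_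
      filter_upwards [hΓ.ae_norm_deriv_le ht hx, ae_restrict_mem measurableSet_Ici] with τ h hτ
      rw [indicator_of_mem (show τ ∈ Ici 0 from ht.trans hτ)]
      exact h
    rw [intervalIntegral.integral_add (hγ₀i t r) hi2] at h1
    have h2 := hΓ.integral_γ₀_mono le_rfl hr.1 hr.2
    rw [hx.1.eq_add_integral ht (ht.trans hr.1), hx.2.2]
    exact (norm_add_le _ _).trans (by linarith)
  have h := gronwall_integral hΓ.γ₁_locallyIntegrable hΓ.γ₁_nonneg
    (hxc.mono Icc_subset_Ici_self).norm hA0 hbound s ⟨hs, le_rfl⟩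
  refine h.trans ?_
  have h3 := hΓ.integral_γ₀_mono ht hs le_rfl
  have h4 := Real.exp_le_exp.2 (hΓ.integral_γ₁_mono ht hs le_rfl)
  -- Turning the sum into a product separates the initial point from the weight that appears in
  -- (H7).
  have h5 : A ≤ (‖ξ‖ + 1) * (1 + ∫ τ in (0 : ℝ)..s, γ₀ τ) := by
    nlinarith [mul_nonneg (norm_nonneg ξ) (hI0.trans h3)]
  calc A * Real.exp (∫ τ in t..s, γ₁ τ)
      ≤ ((‖ξ‖ + 1) * (1 + ∫ τ in (0 : ℝ)..s, γ₀ τ)) * Real.exp (∫ τ in (0 : ℝ)..s, γ₁ τ) :=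
        mul_le_mul h5 h4 (Real.exp_pos _).le (hA0.trans h5)
    _ = _ := by ring

end IsLipschitzMultifunction

end Trajectories

/-! ### Cost estimates along trajectories -/

section ControlProblem

variable {E : Type*} [NormedAddCommGroup E]

/-- The weight `exp (∫₀ˢ γ₁) (l₁ + l₂ γ₁)`, whose tail integrals are the Lipschitz ranks of the value
function. -/
noncomputable def rankDensity (l₁ l₂ γ₁ : ℝ → ℝ) (s : ℝ) : ℝ :=
  Real.exp (∫ τ in (0 : ℝ)..s, γ₁ τ) * (l₁ s + l₂ s * γ₁ s)

/-- Filippov's estimate produces exp(∫ₜˢγ₁); enlarging it to exp(∫₀ˢγ₁) makes the integrand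
independent of t, so that this is a genuine tail integral. -/
noncomputable def lipschitzRank (l₁ l₂ γ₁ : ℝ → ℝ) (t : ℝ) : ℝ :=
  ∫ s in Ioi t, rankDensity l₁ l₂ γ₁ s

/-- A bound for trajectories starting from the ball of radius `r`. -/
noncomputable def stateBound (γ₀ γ₁ : ℝ → ℝ) (r s : ℝ) : ℝ :=
  (r + 1) * (Real.exp (∫ τ in (0 : ℝ)..s, γ₁ τ) * (1 + ∫ τ in (0 : ℝ)..s, γ₀ τ))

/-- A bound for the speed of trajectories starting from the ball of radius `r`. -/
noncomputable def speedBound (γ₀ γ₁ : ℝ → ℝ) (r s : ℝ) : ℝ :=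
  γ₀ s + γ₁ s * stateBound γ₀ γ₁ r s

/-- A bound for the running cost along trajectories starting from the ball of radius `r`. -/
noncomputable def costBound (l₀ l₁ l₂ γ₀ γ₁ : ℝ → ℝ) (r s : ℝ) : ℝ :=
  l₀ s + l₂ s * γ₀ s + (l₁ s + l₂ s * γ₁ s) * stateBound γ₀ γ₁ r s

/-- An infinite horizon problem with a real-valued Lipschitz running cost and Lipschitz dynamics. -/
structure IsControlProblem [NormedSpace ℝ E] (ℓ : ℝ → E → E → ℝ) (Γ : ℝ → E → Set E)
    (l₀ l₁ l₂ γ₀ γ₁ : ℝ → ℝ) : Prop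
    extends IsLipschitzMultifunction Γ γ₀ γ₁ where
  admissible_nonempty : ∀ t, 0 ≤ t → ∀ ξ, (admissible Γ t ξ).Nonempty
  aemeasurable_cost : ∀ x y, AEMeasurable (fun s => ℓ s x y) (volume.restrict (Ici 0))
  abs_zero_le : ∀ᵐ s ∂(volume.restrict (Ici (0 : ℝ))), |ℓ s 0 0| ≤ l₀ s
  abs_sub_le : ∀ᵐ s ∂(volume.restrict (Ici (0 : ℝ))), ∀ x y x' y',
    |ℓ s x y - ℓ s x' y'| ≤ l₁ s * ‖x - x'‖ + l₂ s * ‖y - y'‖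
  l₀_nonneg : ∀ s, 0 ≤ s → 0 ≤ l₀ s
  l₁_nonneg : ∀ s, 0 ≤ s → 0 ≤ l₁ s
  l₂_nonneg : ∀ s, 0 ≤ s → 0 ≤ l₂ s
  l₀_integrableOn : IntegrableOn l₀ (Ici 0)
  l₁_integrableOn : IntegrableOn l₁ (Ici 0)
  l₂_integrableOn : IntegrableOn l₂ (Ici 0)
  integrableOn_growth : IntegrableOn (fun s => Real.exp (∫ τ in (0 : ℝ)..s, γ₁ τ) *
    (1 + ∫ τ in (0 : ℝ)..s, γ₀ τ) * (l₁ s + l₂ s * γ₁ s)) (Ici 0)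
  integrableOn_l₂γ₀ : IntegrableOn (fun s => l₂ s * γ₀ s) (Ici 0)

variable [NormedSpace ℝ E]

/-- The cost of an arc on `[t, ∞)`. -/
noncomputable def totalCost (ℓ : ℝ → E → E → ℝ) (t : ℝ) (x : ℝ → E) : ℝ :=
  ∫ s in Ioi t, ℓ s (x s) (deriv x s)

noncomputable def realValue (ℓ : ℝ → E → E → ℝ) (Γ : ℝ → E → Set E) (t : ℝ) (ξ : E) : ℝ :=
  sInf (totalCost ℓ t '' admissible Γ t ξ)

namespace IsControlProblem

variable {ℓ : ℝ → E → E → ℝ} {Γ : ℝ → E → Set E} {l₀ l₁ l₂ γ₀ γ₁ : ℝ → ℝ}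

theorem stateBound_nonneg (h : IsControlProblem ℓ Γ l₀ l₁ l₂ γ₀ γ₁) {r s : ℝ} (hr : 0 ≤ r)
    (hs : 0 ≤ s) : 0 ≤ stateBound γ₀ γ₁ r s := by
  have := intervalIntegral.integral_nonneg (μ := volume) hs fun u _ => h.γ₀_nonneg u
  unfold stateBound
  positivity

theorem stateBound_mono (h : IsControlProblem ℓ Γ l₀ l₁ l₂ γ₀ γ₁) {r r' s : ℝ} (hr : r ≤ r')
    (hs : 0 ≤ s) : stateBound γ₀ γ₁ r s ≤ stateBound γ₀ γ₁ r' s := by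
  have := intervalIntegral.integral_nonneg (μ := volume) hs fun u _ => h.γ₀_nonneg u
  unfold stateBound
  gcongr

theorem continuous_stateBound (h : IsControlProblem ℓ Γ l₀ l₁ l₂ γ₀ γ₁) (r : ℝ) :
    Continuous (stateBound γ₀ γ₁ r) :=
  continuous_const.mul ((h.γ₁_locallyIntegrable.continuous_integral 0).rexp.mul
    (continuous_const.add (h.γ₀_locallyIntegrable.continuous_integral 0)))

theorem locallyIntegrable_speedBound (h : IsControlProblem ℓ Γ l₀ l₁ l₂ γ₀ γ₁) (r : ℝ) :
    LocallyIntegrable (speedBound γ₀ γ₁ r) volume :=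
  h.γ₀_locallyIntegrable.add (h.γ₁_locallyIntegrable.mul_continuous (h.continuous_stateBound r))

theorem rank_coeff_nonneg (h : IsControlProblem ℓ Γ l₀ l₁ l₂ γ₀ γ₁) {s : ℝ} (hs : 0 ≤ s) :
    0 ≤ l₁ s + l₂ s * γ₁ s :=
  add_nonneg (h.l₁_nonneg s hs) (mul_nonneg (h.l₂_nonneg s hs) (h.γ₁_nonneg s))

theorem rankDensity_nonneg (h : IsControlProblem ℓ Γ l₀ l₁ l₂ γ₀ γ₁) {s : ℝ} (hs : 0 ≤ s) :
    0 ≤ rankDensity l₁ l₂ γ₁ s :=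
  mul_nonneg (Real.exp_pos _).le (h.rank_coeff_nonneg hs)

theorem integrableOn_rankDensity (h : IsControlProblem ℓ Γ l₀ l₁ l₂ γ₀ γ₁) :
    IntegrableOn (rankDensity l₁ l₂ γ₁) (Ici 0) := by
  refine Integrable.mono' h.integrableOn_growth ?_ ?_
  · exact (h.γ₁_locallyIntegrable.continuous_integral 0).rexp.aestronglyMeasurable.mul
      (h.l₁_integrableOn.aestronglyMeasurable.add (h.l₂_integrableOn.aestronglyMeasurable.mul
        h.γ₁_locallyIntegrable.aestronglyMeasurable.restrict))
  · filter_upwards [ae_restrict_mem measurableSet_Ici] with s hs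
    have h0 := intervalIntegral.integral_nonneg (μ := volume) hs fun u _ => h.γ₀_nonneg u
    rw [Real.norm_of_nonneg (h.rankDensity_nonneg hs), rankDensity]
    refine mul_le_mul_of_nonneg_right ?_ (h.rank_coeff_nonneg hs)
    exact le_mul_of_one_le_right (Real.exp_pos _).le (by linarith)

theorem costBound_nonneg (h : IsControlProblem ℓ Γ l₀ l₁ l₂ γ₀ γ₁) {r s : ℝ} (hr : 0 ≤ r)
    (hs : 0 ≤ s) : 0 ≤ costBound l₀ l₁ l₂ γ₀ γ₁ r s :=
  add_nonneg (add_nonneg (h.l₀_nonneg s hs) (mul_nonneg (h.l₂_nonneg s hs) (h.γ₀_nonneg s)))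
    (mul_nonneg (h.rank_coeff_nonneg hs) (h.stateBound_nonneg hr hs))

theorem integrableOn_costBound (h : IsControlProblem ℓ Γ l₀ l₁ l₂ γ₀ γ₁) (r : ℝ) :
    IntegrableOn (costBound l₀ l₁ l₂ γ₀ γ₁ r) (Ici 0) := by
  refine ((h.l₀_integrableOn.add h.integrableOn_l₂γ₀).add
    (h.integrableOn_growth.const_mul (r + 1))).congr (Eventually.of_forall fun s => ?_)
  simp only [Pi.add_apply, costBound, stateBound]
  ring

theorem costBound_mono (h : IsControlProblem ℓ Γ l₀ l₁ l₂ γ₀ γ₁) {r r' s : ℝ} (hr : r ≤ r')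
    (hs : 0 ≤ s) : costBound l₀ l₁ l₂ γ₀ γ₁ r s ≤ costBound l₀ l₁ l₂ γ₀ γ₁ r' s := by
  have := mul_le_mul_of_nonneg_left (h.stateBound_mono hr hs) (h.rank_coeff_nonneg hs)
  unfold costBound
  linarith

section Cost

variable {t : ℝ} {ξ : E} {x : ℝ → E}

theorem ae_norm_deriv_le_speedBound (h : IsControlProblem ℓ Γ l₀ l₁ l₂ γ₀ γ₁) (ht : 0 ≤ t)
    (hx : x ∈ admissible Γ t ξ) :
    ∀ᵐ s ∂(volume.restrict (Ici t)), ‖deriv x s‖ ≤ speedBound γ₀ γ₁ ‖ξ‖ s := by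
  filter_upwards [h.ae_norm_deriv_le ht hx, ae_restrict_mem measurableSet_Ici] with s hd hs
  have := mul_le_mul_of_nonneg_left (h.norm_le_growth ht hx hs) (h.γ₁_nonneg s)
  simp only [speedBound, stateBound]
  linarith

theorem norm_sub_le_integral_speedBound (h : IsControlProblem ℓ Γ l₀ l₁ l₂ γ₀ γ₁) (ht : 0 ≤ t)
    (hx : x ∈ admissible Γ t ξ) {s : ℝ} (hs : t ≤ s) :
    ‖x s - ξ‖ ≤ ∫ τ in t..s, speedBound γ₀ γ₁ ‖ξ‖ τ := by
  have hf₀ := locallyIntegrable_indicator_of_locallyIntegrableOn hx.1.locallyIntegrable_deriv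
  rw [hx.1.eq_add_integral ht (ht.trans hs), hx.2.2, add_sub_cancel_left]
  refine (intervalIntegral.norm_integral_le_integral_norm hs).trans ?_
  refine intervalIntegral.integral_mono_ae_restrict hs (hf₀.intervalIntegrable_real t s).norm
    ((h.locallyIntegrable_speedBound ‖ξ‖).intervalIntegrable_real t s) ?_
  refine ae_restrict_of_ae_restrict_of_subset (t := Ici t) Icc_subset_Ici_self ?_
  filter_upwards [h.ae_norm_deriv_le_speedBound ht hx, ae_restrict_mem measurableSet_Ici] with τ h hτ
  rw [indicator_of_mem (show τ ∈ Ici 0 from ht.trans hτ)]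
  exact h

/-- Comparison with the cost at (0, 0) gives l₀ + l₁‖x‖ + l₂‖ẋ‖; the velocity and growth bounds then
apply. -/
theorem ae_abs_cost_le (h : IsControlProblem ℓ Γ l₀ l₁ l₂ γ₀ γ₁) (ht : 0 ≤ t)
    (hx : x ∈ admissible Γ t ξ) : ∀ᵐ s ∂(volume.restrict (Ici t)),
      |ℓ s (x s) (deriv x s)| ≤ costBound l₀ l₁ l₂ γ₀ γ₁ ‖ξ‖ s := by
  filter_upwards [h.ae_norm_deriv_le ht hx, ae_restrict_mem measurableSet_Ici,
    ae_restrict_Ici_mono ht h.abs_zero_le, ae_restrict_Ici_mono ht h.abs_sub_le] with s hd hs h0 hl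
  have hs0 : 0 ≤ s := ht.trans hs
  have h1 := hl (x s) (deriv x s) 0 0
  rw [sub_zero, sub_zero] at h1
  have h2 := abs_sub_abs_le_abs_sub (ℓ s (x s) (deriv x s)) (ℓ s 0 0)
  have h3 := mul_le_mul_of_nonneg_left hd (h.l₂_nonneg s hs0)
  have h4 := mul_le_mul_of_nonneg_left (h.norm_le_growth ht hx hs) (h.rank_coeff_nonneg hs0)
  simp only [costBound, stateBound]
  linarith

theorem aemeasurable_cost_admissible (h : IsControlProblem ℓ Γ l₀ l₁ l₂ γ₀ γ₁) (ht : 0 ≤ t)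
    (hx : x ∈ admissible Γ t ξ) :
    AEMeasurable (fun s => ℓ s (x s) (deriv x s)) (volume.restrict (Ici t)) := by
  have hsub : Ici t ⊆ Ici 0 := Ici_subset_Ici.2 ht
  refine aemeasurable_caratheodory (G := fun s (p : E × E) => ℓ s p.1 p.2)
    (h := fun s => (x s, deriv x s)) (fun p => ?_) ?_ ?_
  · exact (h.aemeasurable_cost p.1 p.2).mono_measure (Measure.restrict_mono hsub le_rfl)
  · filter_upwards [ae_restrict_Ici_mono ht h.abs_sub_le, ae_restrict_mem measurableSet_Ici]
      with s hl hs
    have hs0 : 0 ≤ s := ht.trans hs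
    refine (LipschitzWith.of_le_add_mul
      ⟨l₁ s + l₂ s, add_nonneg (h.l₁_nonneg s hs0) (h.l₂_nonneg s hs0)⟩ fun p q => ?_).continuous
    have h1 := (le_abs_self _).trans (hl p.1 p.2 q.1 q.2)
    have h2 : ‖p.1 - q.1‖ ≤ dist p q := by rw [← dist_eq_norm]; exact le_max_left _ _
    have h3 : ‖p.2 - q.2‖ ≤ dist p q := by rw [← dist_eq_norm]; exact le_max_right _ _
    have h4 := mul_le_mul_of_nonneg_left h2 (h.l₁_nonneg s hs0)
    have h5 := mul_le_mul_of_nonneg_left h3 (h.l₂_nonneg s hs0)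
    change _ ≤ _ + (l₁ s + l₂ s) * _
    linarith
  · exact ((hx.1.continuousOn.mono hsub).aestronglyMeasurable measurableSet_Ici).prodMk
      ((aestronglyMeasurable_deriv_of_isArc hx.1).mono_set hsub)

theorem integrableOn_cost (h : IsControlProblem ℓ Γ l₀ l₁ l₂ γ₀ γ₁) (ht : 0 ≤ t)
    (hx : x ∈ admissible Γ t ξ) :
    IntegrableOn (fun s => ℓ s (x s) (deriv x s)) (Ici t) :=
  ((h.integrableOn_costBound ‖ξ‖).mono_set (Ici_subset_Ici.2 ht)).mono'
    (h.aemeasurable_cost_admissible ht hx).aestronglyMeasurable (h.ae_abs_cost_le ht hx)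

theorem abs_totalCost_le (h : IsControlProblem ℓ Γ l₀ l₁ l₂ γ₀ γ₁) (ht : 0 ≤ t)
    (hx : x ∈ admissible Γ t ξ) {r : ℝ} (hr : ‖ξ‖ ≤ r) :
    |totalCost ℓ t x| ≤ ∫ s in Ici 0, costBound l₀ l₁ l₂ γ₀ γ₁ r s := by
  have hi := h.integrableOn_costBound r
  rw [totalCost, ← integral_Ici_eq_integral_Ioi]
  have h1 : |∫ s in Ici t, ℓ s (x s) (deriv x s)| ≤
      ∫ s in Ici t, costBound l₀ l₁ l₂ γ₀ γ₁ r s := by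
    rw [← Real.norm_eq_abs]
    refine norm_integral_le_of_norm_le (hi.mono_set (Ici_subset_Ici.2 ht)) ?_
    filter_upwards [h.ae_abs_cost_le ht hx, ae_restrict_mem measurableSet_Ici] with s h1 hs
    exact h1.trans (h.costBound_mono hr (ht.trans hs))
  refine h1.trans (setIntegral_mono_set hi ?_ (Ici_subset_Ici.2 ht).eventuallyLE)
  filter_upwards [ae_restrict_mem measurableSet_Ici] with s hs
  exact h.costBound_nonneg ((norm_nonneg ξ).trans hr) hs

theorem totalCost_eq_add (h : IsControlProblem ℓ Γ l₀ l₁ l₂ γ₀ γ₁) (ht : 0 ≤ t)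
    (hx : x ∈ admissible Γ t ξ) {t' : ℝ} (htt' : t ≤ t') :
    totalCost ℓ t x = (∫ s in t..t', ℓ s (x s) (deriv x s)) + totalCost ℓ t' x := by
  have hi := (h.integrableOn_cost ht hx).mono_set Ioi_subset_Ici_self
  exact (intervalIntegral.integral_interval_add_Ioi hi (hi.mono_set (Ioi_subset_Ioi htt'))).symm

theorem abs_integral_cost_le (h : IsControlProblem ℓ Γ l₀ l₁ l₂ γ₀ γ₁) (ht : 0 ≤ t)
    (hx : x ∈ admissible Γ t ξ) {t' : ℝ} (htt' : t ≤ t') :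
    |∫ s in t..t', ℓ s (x s) (deriv x s)| ≤
      ∫ s in t..t', costBound l₀ l₁ l₂ γ₀ γ₁ ‖ξ‖ s := by
  rw [← Real.norm_eq_abs]
  refine intervalIntegral.norm_integral_le_of_norm_le htt' ?_ ?_
  · have := h.ae_abs_cost_le ht hx
    rw [ae_restrict_iff' measurableSet_Ici] at this
    filter_upwards [this] with s hs hs'
    exact hs hs'.1.le
  · rw [intervalIntegrable_iff_integrableOn_Icc_of_le htt']
    exact (h.integrableOn_costBound ‖ξ‖).mono_set fun s hs => ht.trans hs.1

/-- The Lipschitz estimate for the cost is integrated along the Filippov neighbor. The residual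
velocity error η exp(-s) ≤ η contributes the last term. -/
theorem exists_totalCost_le [CompleteSpace E] [TopologicalSpace.SeparableSpace E]
    (h : IsControlProblem ℓ Γ l₀ l₁ l₂ γ₀ γ₁) (ht : 0 ≤ t) (hx : x ∈ admissible Γ t ξ) (ξ' : E)
    {η : ℝ} (hη : 0 < η) : ∃ x' ∈ admissible Γ t ξ', totalCost ℓ t x' ≤ totalCost ℓ t x +
      ((‖ξ - ξ'‖ + η) * lipschitzRank l₁ l₂ γ₁ t + η * ∫ s in Ioi t, l₂ s) := by
  obtain ⟨x', hx', hd, hd'⟩ := h.exists_neighboring_admissible ht ξ' hx hη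
  refine ⟨x', hx', ?_⟩
  have hsub : Ioi t ⊆ Ici 0 := fun s hs => ht.trans (le_of_lt hs)
  have hi1 := (h.integrableOn_rankDensity.mono_set hsub).const_mul (‖ξ - ξ'‖ + η)
  have hi2 := (h.l₂_integrableOn.mono_set hsub).const_mul η
  have hi3 := (h.integrableOn_cost ht hx).mono_set Ioi_subset_Ici_self
  have hi4 := (h.integrableOn_cost ht hx').mono_set Ioi_subset_Ici_self
  have hi5 : IntegrableOn (fun s => (‖ξ - ξ'‖ + η) * rankDensity l₁ l₂ γ₁ s + η * l₂ s) (Ioi t) :=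
    hi1.add hi2
  rw [totalCost, totalCost, lipschitzRank, ← integral_const_mul, ← integral_const_mul,
    ← integral_add hi1 hi2, ← integral_add hi3 hi5]
  refine integral_mono_ae hi4 (hi3.add hi5) ?_
  refine ae_restrict_of_ae_restrict_of_subset (t := Ici t) Ioi_subset_Ici_self ?_
  filter_upwards [hd', ae_restrict_mem measurableSet_Ici, ae_restrict_Ici_mono ht h.abs_sub_le]
    with s hds hs hl
  have hs0 : 0 ≤ s := ht.trans hs
  have h1 := (le_abs_self _).trans (hl (x' s) (deriv x' s) (x s) (deriv x s))
  have h2 := mul_le_mul_of_nonneg_left (hd s hs) (h.l₁_nonneg s hs0)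
  have h3 := mul_le_mul_of_nonneg_left hds (h.l₂_nonneg s hs0)
  have h4 : (‖ξ - ξ'‖ + η) * Real.exp (∫ τ in t..s, γ₁ τ) * (l₁ s + l₂ s * γ₁ s) ≤
      (‖ξ - ξ'‖ + η) * rankDensity l₁ l₂ γ₁ s := by
    rw [rankDensity, ← mul_assoc]
    refine mul_le_mul_of_nonneg_right ?_ (h.rank_coeff_nonneg hs0)
    refine mul_le_mul_of_nonneg_left ?_ (add_nonneg (norm_nonneg _) hη.le)
    exact Real.exp_le_exp.2 (h.integral_γ₁_mono ht hs le_rfl)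
  have h5 : l₂ s * (η * Real.exp (-s)) ≤ η * l₂ s := by
    have h6 : Real.exp (-s) ≤ 1 := Real.exp_le_one_iff.2 (by linarith)
    have h7 := mul_le_mul_of_nonneg_left h6 (mul_nonneg hη.le (h.l₂_nonneg s hs0))
    linarith
  change ℓ s (x' s) (deriv x' s) ≤ ℓ s (x s) (deriv x s) +
    ((‖ξ - ξ'‖ + η) * rankDensity l₁ l₂ γ₁ s + η * l₂ s)
  linarith

end Cost

end IsControlProblem

end ControlProblem

/-! ### Regularity of the value function -/

section Value

variable {E : Type*} [NormedAddCommGroup E] [NormedSpace ℝ E]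
  {ℓ : ℝ → E → E → ℝ} {Γ : ℝ → E → Set E} {l₀ l₁ l₂ γ₀ γ₁ : ℝ → ℝ}

namespace IsControlProblem

theorem lipschitzRank_nonneg (h : IsControlProblem ℓ Γ l₀ l₁ l₂ γ₀ γ₁) {t : ℝ} (ht : 0 ≤ t) :
    0 ≤ lipschitzRank l₁ l₂ γ₁ t :=
  setIntegral_nonneg measurableSet_Ioi fun _ hs => h.rankDensity_nonneg (ht.trans (le_of_lt hs))

theorem antitoneOn_lipschitzRank (h : IsControlProblem ℓ Γ l₀ l₁ l₂ γ₀ γ₁) :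
    AntitoneOn (lipschitzRank l₁ l₂ γ₁) (Ici 0) := by
  intro t ht t' _ htt'
  have hsub : Ioi t ⊆ Ici 0 := fun s hs => (show (0 : ℝ) ≤ t from ht).trans (le_of_lt hs)
  refine setIntegral_mono_set (h.integrableOn_rankDensity.mono_set hsub) ?_
    (Ioi_subset_Ioi htt').eventuallyLE
  filter_upwards [ae_restrict_mem measurableSet_Ioi] with s hs
  exact h.rankDensity_nonneg (hsub hs)

theorem lipschitzRank_eq (h : IsControlProblem ℓ Γ l₀ l₁ l₂ γ₀ γ₁) {t : ℝ} (ht : 0 ≤ t) :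
    lipschitzRank l₁ l₂ γ₁ t = lipschitzRank l₁ l₂ γ₁ 0 -
      ∫ s in (0 : ℝ)..t, (Ici 0).indicator (rankDensity l₁ l₂ γ₁) s := by
  have hi := h.integrableOn_rankDensity.mono_set Ioi_subset_Ici_self
  rw [integral_indicator_Ici_interval _ le_rfl ht, lipschitzRank, lipschitzRank,
    ← intervalIntegral.integral_interval_add_Ioi hi (hi.mono_set (Ioi_subset_Ioi ht))]
  ring

theorem continuousOn_lipschitzRank (h : IsControlProblem ℓ Γ l₀ l₁ l₂ γ₀ γ₁) :
    ContinuousOn (lipschitzRank l₁ l₂ γ₁) (Ici 0) :=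
  (continuous_const.sub ((locallyIntegrable_indicator_of_locallyIntegrableOn
    h.integrableOn_rankDensity.locallyIntegrableOn).continuous_integral 0)).continuousOn.congr
    fun _ ht => h.lipschitzRank_eq ht

theorem tendsto_lipschitzRank (h : IsControlProblem ℓ Γ l₀ l₁ l₂ γ₀ γ₁) :
    Tendsto (lipschitzRank l₁ l₂ γ₁) atTop (𝓝 0) := by
  have hi := h.integrableOn_rankDensity.mono_set Ioi_subset_Ici_self
  have h1 := (intervalIntegral_tendsto_integral_Ioi 0 hi tendsto_id).const_sub
    (lipschitzRank l₁ l₂ γ₁ 0)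
  rw [← lipschitzRank, sub_self] at h1
  refine h1.congr' ?_
  filter_upwards [eventually_ge_atTop 0] with t ht
  rw [h.lipschitzRank_eq ht, integral_indicator_Ici_interval _ le_rfl ht]
  rfl

variable {t : ℝ}

theorem bddBelow_totalCost (h : IsControlProblem ℓ Γ l₀ l₁ l₂ γ₀ γ₁) (ht : 0 ≤ t) (ξ : E) :
    BddBelow (totalCost ℓ t '' admissible Γ t ξ) := by
  refine ⟨-∫ s in Ici 0, costBound l₀ l₁ l₂ γ₀ γ₁ ‖ξ‖ s, ?_⟩
  rintro _ ⟨x, hx, rfl⟩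
  exact (abs_le.1 (h.abs_totalCost_le ht hx le_rfl)).1

theorem realValue_le (h : IsControlProblem ℓ Γ l₀ l₁ l₂ γ₀ γ₁) (ht : 0 ≤ t) {ξ : E} {x : ℝ → E}
    (hx : x ∈ admissible Γ t ξ) : realValue ℓ Γ t ξ ≤ totalCost ℓ t x :=
  csInf_le (h.bddBelow_totalCost ht ξ) (mem_image_of_mem _ hx)

theorem le_realValue (h : IsControlProblem ℓ Γ l₀ l₁ l₂ γ₀ γ₁) (ht : 0 ≤ t) {ξ : E} {c : ℝ}
    (hc : ∀ x ∈ admissible Γ t ξ, c ≤ totalCost ℓ t x) : c ≤ realValue ℓ Γ t ξ := by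
  refine le_csInf ((h.admissible_nonempty t ht ξ).image _) ?_
  rintro _ ⟨x, hx, rfl⟩
  exact hc x hx

theorem abs_realValue_le (h : IsControlProblem ℓ Γ l₀ l₁ l₂ γ₀ γ₁) (ht : 0 ≤ t) {ξ : E} {r : ℝ}
    (hr : ‖ξ‖ ≤ r) :
    |realValue ℓ Γ t ξ| ≤ ∫ s in Ici 0, costBound l₀ l₁ l₂ γ₀ γ₁ r s := by
  obtain ⟨x, hx⟩ := h.admissible_nonempty t ht ξ
  rw [abs_le]
  exact ⟨h.le_realValue ht fun x hx => (abs_le.1 (h.abs_totalCost_le ht hx hr)).1,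
    (h.realValue_le ht hx).trans (abs_le.1 (h.abs_totalCost_le ht hx hr)).2⟩

theorem realValue_le_add [CompleteSpace E] [TopologicalSpace.SeparableSpace E]
    (h : IsControlProblem ℓ Γ l₀ l₁ l₂ γ₀ γ₁) (ht : 0 ≤ t) (ξ ξ' : E) :
    realValue ℓ Γ t ξ' ≤ realValue ℓ Γ t ξ + lipschitzRank l₁ l₂ γ₁ t * ‖ξ - ξ'‖ := by
  rw [← sub_le_iff_le_add]
  refine h.le_realValue ht fun x hx => ?_
  set C := ∫ s in Ioi t, l₂ s
  have hlim : Tendsto (fun η => totalCost ℓ t x +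
      ((‖ξ - ξ'‖ + η) * lipschitzRank l₁ l₂ γ₁ t + η * C)) (𝓝[>] 0)
      (𝓝 (totalCost ℓ t x + ((‖ξ - ξ'‖ + 0) * lipschitzRank l₁ l₂ γ₁ t + 0 * C))) :=
    (by fun_prop : Continuous fun η => totalCost ℓ t x +
      ((‖ξ - ξ'‖ + η) * lipschitzRank l₁ l₂ γ₁ t + η * C)).continuousWithinAt
  have hle := ge_of_tendsto hlim (b := realValue ℓ Γ t ξ') (by
    filter_upwards [self_mem_nhdsWithin] with η hη
    obtain ⟨x', hx', hc⟩ := h.exists_totalCost_le ht hx ξ' hη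
    exact (h.realValue_le ht hx').trans hc)
  linarith

theorem abs_realValue_sub_le [CompleteSpace E] [TopologicalSpace.SeparableSpace E]
    (h : IsControlProblem ℓ Γ l₀ l₁ l₂ γ₀ γ₁) (ht : 0 ≤ t) (ξ ξ' : E) :
    |realValue ℓ Γ t ξ - realValue ℓ Γ t ξ'| ≤ lipschitzRank l₁ l₂ γ₁ t * ‖ξ - ξ'‖ := by
  have h1 := h.realValue_le_add ht ξ ξ'
  have h2 := h.realValue_le_add ht ξ' ξ
  rw [norm_sub_rev] at h2
  rw [abs_le]
  constructor <;> linarith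

/-- Dynamic programming inequality. -/
theorem realValue_le_integral_add [CompleteSpace E]
    (h : IsControlProblem ℓ Γ l₀ l₁ l₂ γ₀ γ₁) (ht : 0 ≤ t) {t' : ℝ} (htt' : t ≤ t') {ξ : E}
    {x : ℝ → E} (hx : x ∈ admissible Γ t ξ) :
    realValue ℓ Γ t ξ ≤ (∫ s in t..t', ℓ s (x s) (deriv x s)) + realValue ℓ Γ t' (x t') := by
  rw [← sub_le_iff_le_add']
  refine h.le_realValue (ht.trans htt') fun x₁ hx₁ => ?_
  obtain ⟨y, hy, hy0, hy1⟩ := admissible_concat ht htt' hx hx₁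
  have h1 := h.realValue_le ht hy
  rw [h.totalCost_eq_add ht hy htt'] at h1
  have h2 : ∫ s in t..t', ℓ s (y s) (deriv y s) = ∫ s in t..t', ℓ s (x s) (deriv x s) := by
    refine intervalIntegral.integral_congr_ae ?_
    filter_upwards [hy0] with s hs hs'
    rw [uIoc_of_le htt'] at hs'
    rw [(hs hs').1, (hs hs').2]
  have h3 : totalCost ℓ t' y = totalCost ℓ t' x₁ := by
    refine setIntegral_congr_ae measurableSet_Ioi ?_
    filter_upwards [hy1] with s hs hs'
    rw [(hs hs').1, (hs hs').2]
  rw [h2, h3] at h1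
  linarith

/-- Both values are compared with the value at (t', x t') for a trajectory x from (t, ξ): the cost
on [t, t'] links it to the first, the displacement of x and the Lipschitz bound to the second. One
direction needs a single trajectory and concatenation; the other holds for every trajectory, by
restriction. -/
theorem abs_realValue_sub_time_le [CompleteSpace E] [TopologicalSpace.SeparableSpace E]
    (h : IsControlProblem ℓ Γ l₀ l₁ l₂ γ₀ γ₁) (ht : 0 ≤ t) {t' : ℝ} (htt' : t ≤ t') (ξ : E) :
    |realValue ℓ Γ t ξ - realValue ℓ Γ t' ξ| ≤
      (∫ s in t..t', costBound l₀ l₁ l₂ γ₀ γ₁ ‖ξ‖ s) +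
        lipschitzRank l₁ l₂ γ₁ 0 * ∫ s in t..t', speedBound γ₀ γ₁ ‖ξ‖ s := by
  have ht' := ht.trans htt'
  have key : ∀ x ∈ admissible Γ t ξ, |realValue ℓ Γ t' (x t') - realValue ℓ Γ t' ξ| ≤
      lipschitzRank l₁ l₂ γ₁ 0 * ∫ s in t..t', speedBound γ₀ γ₁ ‖ξ‖ s := by
    intro x hx
    refine (h.abs_realValue_sub_le ht' _ _).trans ?_
    exact mul_le_mul (h.antitoneOn_lipschitzRank self_mem_Ici ht' ht')
      (h.norm_sub_le_integral_speedBound ht hx htt') (norm_nonneg _)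
      (h.lipschitzRank_nonneg le_rfl)
  rw [abs_sub_le_iff]
  constructor
  · obtain ⟨x, hx⟩ := h.admissible_nonempty t ht ξ
    have h1 := h.realValue_le_integral_add ht htt' hx
    have h2 := (abs_le.1 (h.abs_integral_cost_le ht hx htt')).2
    have h3 := (abs_le.1 (key x hx)).2
    linarith
  · rw [sub_le_comm]
    refine h.le_realValue ht fun x hx => ?_
    have h1 := h.realValue_le ht' (admissible_restrict htt' hx)
    rw [h.totalCost_eq_add ht hx htt']
    have h2 := (abs_le.1 (h.abs_integral_cost_le ht hx htt')).1
    have h3 := (abs_le.1 (key x hx)).1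
    linarith

theorem continuousOn_realValue [CompleteSpace E] [TopologicalSpace.SeparableSpace E]
    (h : IsControlProblem ℓ Γ l₀ l₁ l₂ γ₀ γ₁) :
    ContinuousOn (fun p : ℝ × E => realValue ℓ Γ p.1 p.2) (Ici 0 ×ˢ univ) := by
  rintro ⟨t₀, ξ₀⟩ ⟨ht₀, -⟩
  have ht₀' : 0 ≤ t₀ := ht₀
  have hC := locallyIntegrable_indicator_of_locallyIntegrableOn
    (h.integrableOn_costBound ‖ξ₀‖).locallyIntegrableOn
  have hS := h.locallyIntegrable_speedBound ‖ξ₀‖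
  set K := lipschitzRank l₁ l₂ γ₁ 0
  -- The state is moved to ξ₀ at time t, and only then is time changed, so the moduli involve the
  -- fixed radius ‖ξ₀‖ alone.
  set ω : ℝ × E → ℝ := fun p =>
    |∫ s in t₀..p.1, (Ici 0).indicator (costBound l₀ l₁ l₂ γ₀ γ₁ ‖ξ₀‖) s| +
      K * |∫ s in t₀..p.1, speedBound γ₀ γ₁ ‖ξ₀‖ s| + K * ‖p.2 - ξ₀‖ with hω
  have hωc : Continuous ω := by
    have h1 := (hC.continuous_integral t₀).comp (continuous_fst (X := ℝ) (Y := E))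
    have h2 := (hS.continuous_integral t₀).comp (continuous_fst (X := ℝ) (Y := E))
    exact (h1.abs.add (continuous_const.mul h2.abs)).add
      (continuous_const.mul (continuous_snd.sub continuous_const).norm)
  have hω0 : ω (t₀, ξ₀) = 0 := by simp [hω]
  have hbound : ∀ p ∈ (Ici 0 ×ˢ univ : Set (ℝ × E)),
      dist (realValue ℓ Γ p.1 p.2) (realValue ℓ Γ t₀ ξ₀) ≤ ω p := by
    rintro ⟨t, ξ⟩ ⟨ht, -⟩
    have ht' : 0 ≤ t := ht
    have h1 : |realValue ℓ Γ t ξ - realValue ℓ Γ t ξ₀| ≤ K * ‖ξ - ξ₀‖ :=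
      (h.abs_realValue_sub_le ht' ξ ξ₀).trans (mul_le_mul_of_nonneg_right
        (h.antitoneOn_lipschitzRank self_mem_Ici ht ht') (norm_nonneg _))
    have h2 : |realValue ℓ Γ t ξ₀ - realValue ℓ Γ t₀ ξ₀| ≤
        |∫ s in t₀..t, (Ici 0).indicator (costBound l₀ l₁ l₂ γ₀ γ₁ ‖ξ₀‖) s| +
          K * |∫ s in t₀..t, speedBound γ₀ γ₁ ‖ξ₀‖ s| := by
      have hK := h.lipschitzRank_nonneg le_rfl
      rw [integral_indicator_Ici_interval _ ht₀' ht']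
      rcases le_total t t₀ with htt | htt
      · refine (h.abs_realValue_sub_time_le ht' htt ξ₀).trans ?_
        rw [intervalIntegral.integral_symm t₀ t, intervalIntegral.integral_symm t₀ t]
        exact add_le_add (neg_le_abs _) (mul_le_mul_of_nonneg_left (neg_le_abs _) hK)
      · rw [abs_sub_comm]
        refine (h.abs_realValue_sub_time_le ht₀' htt ξ₀).trans ?_
        exact add_le_add (le_abs_self _) (mul_le_mul_of_nonneg_left (le_abs_self _) hK)
    rw [Real.dist_eq]
    refine (_root_.abs_sub_le _ (realValue ℓ Γ t ξ₀) _).trans ?_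
    simp only [hω]
    linarith
  rw [ContinuousWithinAt, tendsto_iff_dist_tendsto_zero]
  refine squeeze_zero' (Eventually.of_forall fun _ => dist_nonneg)
    (eventually_mem_nhdsWithin.mono hbound) ?_
  rw [← hω0]
  exact hωc.continuousWithinAt

end IsControlProblem

end Value

/-! ### From extended-real to real costs -/

section Extended

theorem extIntegral_eq_integral {f : ℝ → EReal} {g : ℝ → ℝ} {a b : ℝ}
    (hfg : ∀ᵐ s ∂(volume.restrict (Icc a b)), f s = g s) (hg : IntegrableOn g (Icc a b)) :
    ExtIntegralDefined f a b ∧ extIntegral f a b = ((∫ s in Icc a b, g s : ℝ) : EReal) := by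
  have hpos : ∫⁻ s in Icc a b, (f s).toENNReal = ∫⁻ s in Icc a b, ENNReal.ofReal (g s) :=
    lintegral_congr_ae (hfg.mono fun s hs => by simp [hs])
  have hneg : ∫⁻ s in Icc a b, (-f s).toENNReal = ∫⁻ s in Icc a b, ENNReal.ofReal (-g s) :=
    lintegral_congr_ae (hfg.mono fun s hs => by
      simp only [hs, ← EReal.coe_neg, EReal.real_coe_toENNReal])
  have hA : ∫⁻ s in Icc a b, ENNReal.ofReal (g s) ≠ ∞ := hg.lintegral_lt_top.ne
  have hB : ∫⁻ s in Icc a b, ENNReal.ofReal (-g s) ≠ ∞ := hg.neg.lintegral_lt_top.ne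
  refine ⟨⟨?_, Or.inl (hpos ▸ hA)⟩, ?_⟩
  · exact (measurable_coe_real_ereal.comp_aemeasurable
      hg.aestronglyMeasurable.aemeasurable).congr (hfg.mono fun s hs => hs.symm)
  · rw [extIntegral, hpos, hneg, ← EReal.coe_ennreal_toReal hA, ← EReal.coe_ennreal_toReal hB,
      ← EReal.coe_sub, integral_eq_lintegral_pos_part_sub_lintegral_neg_part hg]

theorem hasImproperIntegral_coe {f : ℝ → EReal} {g : ℝ → ℝ} {t : ℝ}
    (hfg : ∀ᵐ s ∂(volume.restrict (Ici t)), f s = g s) (hg : IntegrableOn g (Ici t)) :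
    HasImproperIntegral f t ((∫ s in Ioi t, g s : ℝ) : EReal) := by
  have h : ∀ T, _ := fun T => extIntegral_eq_integral (b := T)
    (ae_restrict_of_ae_restrict_of_subset Icc_subset_Ici_self hfg)
    (hg.mono_set Icc_subset_Ici_self)
  refine ⟨fun T _ => (h T).1, ?_⟩
  have h1 := intervalIntegral_tendsto_integral_Ioi t (hg.mono_set Ioi_subset_Ici_self) tendsto_id
  refine ((continuous_coe_real_ereal.tendsto _).comp h1).congr' ?_
  filter_upwards [eventually_ge_atTop t] with T hT
  rw [(h T).2, integral_Icc_eq_integral_Ioc, ← intervalIntegral.integral_of_le hT]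
  rfl

variable {E : Type*} [NormedAddCommGroup E]

/-- The distance from q is below r exactly when the set meets the open ball of radius r about q, so
(H5) measures the sublevel sets. -/
theorem aemeasurable_infDist_of_nullMeasurableSet {Γ : ℝ → E → Set E}
    (hne : ∀ t, 0 ≤ t → ∀ x, (Γ t x).Nonempty)
    (hm : ∀ x, ∀ U : Set E, IsOpen U →
      NullMeasurableSet {t : ℝ | 0 ≤ t ∧ (Γ t x ∩ U).Nonempty} volume) (x q : E) :
    AEMeasurable (fun s => Metric.infDist q (Γ s x)) (volume.restrict (Ici 0)) := by
  set μ := (volume : Measure ℝ).restrict (Ici 0)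
  have h : Measurable fun s : NullMeasurableSpace ℝ μ => Metric.infDist q (Γ s x) := by
    refine measurable_of_Iio fun r => ?_
    refine ((hm x (Metric.ball q r) Metric.isOpen_ball).mono Measure.restrict_le_self).congr ?_
    filter_upwards [ae_restrict_mem measurableSet_Ici] with s hs
    refine propext ?_
    change (0 ≤ s ∧ (Γ s x ∩ Metric.ball q r).Nonempty) ↔ Metric.infDist q (Γ s x) < r
    rw [Metric.infDist_lt_iff (hne s hs x)]
    constructor
    · rintro ⟨-, y, hy, hyr⟩
      exact ⟨y, hy, by rwa [dist_comm]⟩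
    · rintro ⟨y, hy, hyr⟩
      exact ⟨hs, y, hy, by rwa [Metric.mem_ball, dist_comm]⟩
  exact NullMeasurable.aemeasurable fun s hs => h hs

/-- Infinite values have infinite absolute value: the bound at the origin excludes them there, and
the Lipschitz bound then excludes them everywhere. -/
theorem ae_eq_coe_toReal {L : ℝ → E → E → EReal} {l₀ l₁ l₂ : ℝ → ℝ}
    (H3_zero : ∀ᵐ t ∂(volume.restrict (Ici (0 : ℝ))), (L t 0 0).abs ≤ ENNReal.ofReal (l₀ t))
    (H3_lip : ∀ᵐ t ∂(volume.restrict (Ici (0 : ℝ))), ∀ x y x' y' : E,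
      (L t x y - L t x' y').abs ≤ ENNReal.ofReal (l₁ t * ‖x - x'‖ + l₂ t * ‖y - y'‖)) :
    ∀ᵐ t ∂(volume.restrict (Ici (0 : ℝ))), ∀ x y, L t x y = ((L t x y).toReal : EReal) := by
  filter_upwards [H3_zero, H3_lip] with t h0 hl x y
  obtain ⟨r, hr⟩ : ∃ r : ℝ, L t 0 0 = r := by
    induction hL : L t 0 0 with
    | coe r => exact ⟨r, rfl⟩
    | top => simp [hL] at h0
    | bot => simp [hL] at h0
  have h := hl x y 0 0
  rw [hr] at h
  induction hL : L t x y with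
  | coe r => rfl
  | top => simp [hL] at h
  | bot => simp [hL] at h

variable [NormedSpace ℝ E]

/-- Every admissible trajectory has an integrable cost, so the restriction to well-defined improper
integrals removes nothing, and uniqueness of limits identifies their values. -/
theorem IsControlProblem.valueFunction_eq {L : ℝ → E → E → EReal} {ℓ : ℝ → E → E → ℝ}
    {Γ : ℝ → E → Set E} {l₀ l₁ l₂ γ₀ γ₁ : ℝ → ℝ} (h : IsControlProblem ℓ Γ l₀ l₁ l₂ γ₀ γ₁)
    (hL : ∀ᵐ t ∂(volume.restrict (Ici (0 : ℝ))), ∀ x y, L t x y = (ℓ t x y : EReal))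
    {t : ℝ} (ht : 0 ≤ t) (ξ : E) :
    valueFunction L Γ t ξ = (realValue ℓ Γ t ξ : EReal) := by
  have hJ : ∀ x ∈ admissible Γ t ξ, HasImproperIntegral (fun s => L s (x s) (deriv x s)) t
      (totalCost ℓ t x : EReal) := fun x hx =>
    hasImproperIntegral_coe ((ae_restrict_Ici_mono ht hL).mono fun s hs => hs _ _)
      (h.integrableOn_cost ht hx)
  have hle : ∀ x ∈ admissible Γ t ξ, valueFunction L Γ t ξ ≤ (totalCost ℓ t x : EReal) :=
    fun x hx => sInf_le ⟨x, hx, hJ x hx⟩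
  have hge : (realValue ℓ Γ t ξ : EReal) ≤ valueFunction L Γ t ξ := by
    refine le_sInf ?_
    rintro I ⟨x, hx, hI⟩
    rw [tendsto_nhds_unique hI.2 (hJ x hx).2]
    exact EReal.coe_le_coe_iff.2 (h.realValue_le ht hx)
  refine le_antisymm ?_ hge
  obtain ⟨x₀, hx₀⟩ := h.admissible_nonempty t ht ξ
  have hc : ((valueFunction L Γ t ξ).toReal : EReal) = valueFunction L Γ t ξ :=
    EReal.coe_toReal ((hle x₀ hx₀).trans_lt (EReal.coe_lt_top _)).ne
      ((EReal.bot_lt_coe _).trans_le hge).ne'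
  rw [← hc, EReal.coe_le_coe_iff]
  refine h.le_realValue ht fun x hx => ?_
  rw [← EReal.coe_le_coe_iff, hc]
  exact hle x hx

end Extended

/-! ### Conclusion -/

theorem mainTheorem4 {E : Type*} [NormedAddCommGroup E] [NormedSpace ℝ E] [CompleteSpace E]
    [TopologicalSpace.SeparableSpace E]
    (L : ℝ → E → E → EReal) (Γ : ℝ → E → Set E)
    (l₀ l₁ l₂ γ₀ γ₁ : ℝ → ℝ)
    -- `L` takes values in `ℝ ∪ {+∞}`
    (hL : ∀ t, 0 ≤ t → ∀ x y, L t x y ≠ ⊥)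
    -- (H1)
    (H1 : ∀ t, 0 ≤ t → ∀ ξ, (admissible Γ t ξ).Nonempty)
    -- (H2)
    (H2 : ∀ x y, AEMeasurable (fun t => L t x y) (volume.restrict (Ici 0)))
    -- (H3)
    (hl₀_nonneg : ∀ t, 0 ≤ t → 0 ≤ l₀ t) (hl₀ : IntegrableOn l₀ (Ici 0) volume)
    (hl₁_nonneg : ∀ t, 0 ≤ t → 0 ≤ l₁ t) (hl₁ : IntegrableOn l₁ (Ici 0) volume)
    (hl₂_nonneg : ∀ t, 0 ≤ t → 0 ≤ l₂ t) (hl₂ : IntegrableOn l₂ (Ici 0) volume)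
    (hl₂_bdd : ∀ T, ∃ C, ∀ t ∈ Icc 0 T, l₂ t ≤ C)
    (H3_zero : ∀ᵐ t ∂(volume.restrict (Ici (0 : ℝ))),
      (L t 0 0).abs ≤ ENNReal.ofReal (l₀ t))
    (H3_lip : ∀ᵐ t ∂(volume.restrict (Ici (0 : ℝ))), ∀ x y x' y' : E,
      (L t x y - L t x' y').abs ≤ ENNReal.ofReal (l₁ t * ‖x - x'‖ + l₂ t * ‖y - y'‖))
    -- (H4)
    (H4 : ∀ t, 0 ≤ t → ∀ x, (Γ t x).Nonempty ∧ IsClosed (Γ t x))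
    -- (H5)
    (H5 : ∀ x, ∀ U : Set E, IsOpen U →
      NullMeasurableSet {t : ℝ | 0 ≤ t ∧ (Γ t x ∩ U).Nonempty} volume)
    -- (H6)
    (hγ₀_nonneg : ∀ t, 0 ≤ t → 0 ≤ γ₀ t) (hγ₀ : LocallyIntegrableOn γ₀ (Ici 0) volume)
    (hγ₁_nonneg : ∀ t, 0 ≤ t → 0 ≤ γ₁ t) (hγ₁ : LocallyIntegrableOn γ₁ (Ici 0) volume)
    (H6_zero : ∀ t, 0 ≤ t → Γ t 0 ⊆ γ₀ t • Metric.ball (0 : E) 1)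
    (H6_lip : ∀ t, 0 ≤ t → ∀ x x', Γ t x ⊆ Γ t x' + (γ₁ t * ‖x - x'‖) • Metric.ball (0 : E) 1)
    -- (H7)
    (H7 : IntegrableOn (fun s => Real.exp (∫ τ in (0 : ℝ)..s, γ₁ τ)
      * (1 + ∫ τ in (0 : ℝ)..s, γ₀ τ) * (l₁ s + l₂ s * γ₁ s)) (Ici 0) volume)
    (H7' : IntegrableOn (fun s => l₂ s * γ₀ s) (Ici 0) volume) :
    -- `V` is finite, and bounded on `ℝ₊ × D` for every bounded subset `D` of `E`
    (∀ D : Set E, Bornology.IsBounded D → ∃ M : ℝ, ∀ t, 0 ≤ t → ∀ ξ ∈ D,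
      ((-M : ℝ) : EReal) ≤ valueFunction L Γ t ξ ∧ valueFunction L Γ t ξ ≤ (M : EReal)) ∧
    -- `V` is lower semicontinuous on `ℝ₊ × E`
    LowerSemicontinuousOn (fun p : ℝ × E => valueFunction L Γ p.1 p.2) (Ici 0 ×ˢ univ) ∧
    -- `V(t, ·)` is Lipschitz of rank `k(t)`
    ∃ k : ℝ → ℝ, (∀ t, 0 ≤ t → 0 ≤ k t) ∧ ContinuousOn k (Ici 0) ∧ AntitoneOn k (Ici 0) ∧
      Tendsto k atTop (𝓝 0) ∧
      ∀ t, 0 ≤ t → ∀ ξ ξ' : E,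
        (valueFunction L Γ t ξ - valueFunction L Γ t ξ').abs ≤ ENNReal.ofReal (k t * ‖ξ - ξ'‖) := by
  have hγ : ∀ γ : ℝ → ℝ, (∀ t, 0 ≤ t → 0 ≤ γ t) → ∀ s, 0 ≤ (Ici 0).indicator γ s :=
    fun γ h => indicator_nonneg h
  have hind : ∀ (γ : ℝ → ℝ) (s : ℝ), 0 ≤ s → (Ici 0).indicator γ s = γ s :=
    fun γ s hs => indicator_of_mem (show s ∈ Ici 0 from hs) γ
  have hreal := ae_eq_coe_toReal H3_zero H3_lip
  have hmem : ∀ᵐ s ∂(volume.restrict (Ici (0 : ℝ))), s ∈ Ici (0 : ℝ) :=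
    ae_restrict_mem measurableSet_Ici
  -- Extending γ₀ and γ₁ by zero to negative times gives nonnegativity and local integrability on
  -- all of ℝ without changing any integral over [0, s].
  have hP : IsControlProblem (fun s x y => (L s x y).toReal) Γ l₀ l₁ l₂
      ((Ici 0).indicator γ₀) ((Ici 0).indicator γ₁) :=
    { γ₀_nonneg := hγ _ hγ₀_nonneg
      γ₀_locallyIntegrable := locallyIntegrable_indicator_of_locallyIntegrableOn hγ₀
      γ₁_nonneg := hγ _ hγ₁_nonneg
      γ₁_locallyIntegrable := locallyIntegrable_indicator_of_locallyIntegrableOn hγ₁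
      nonempty := fun s hs x => (H4 s hs x).1
      isClosed := fun s hs x => (H4 s hs x).2
      aemeasurable_infDist :=
        aemeasurable_infDist_of_nullMeasurableSet (fun s hs x => (H4 s hs x).1) H5
      norm_le := by
        intro s hs y hy
        obtain ⟨b, hb, rfl⟩ := H6_zero s hs hy
        rw [hind _ _ hs, norm_smul, Real.norm_of_nonneg (hγ₀_nonneg s hs)]
        exact mul_le_of_le_one_right (hγ₀_nonneg s hs) (mem_ball_zero_iff.1 hb).le
      exists_norm_sub_le := by
        intro s hs x x' y hy
        obtain ⟨y', hy', _, ⟨b, hb, rfl⟩, rfl⟩ := H6_lip s hs x x' hy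
        have h0 : 0 ≤ γ₁ s * ‖x - x'‖ := mul_nonneg (hγ₁_nonneg s hs) (norm_nonneg _)
        refine ⟨y', hy', ?_⟩
        rw [hind _ _ hs, add_sub_cancel_left, norm_smul, Real.norm_of_nonneg h0]
        exact mul_le_of_le_one_right h0 (mem_ball_zero_iff.1 hb).le
      admissible_nonempty := H1
      aemeasurable_cost := fun x y => (H2 x y).ereal_toReal
      abs_zero_le := by
        filter_upwards [hmem, hreal, H3_zero] with s hs hr h
        rw [hr 0 0, EReal.abs_def] at h
        exact (ENNReal.ofReal_le_ofReal_iff (hl₀_nonneg s hs)).1 h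
      abs_sub_le := by
        filter_upwards [hmem, hreal, H3_lip] with s hs hr h x y x' y'
        have h := h x y x' y'
        rw [hr x y, hr x' y', ← EReal.coe_sub, EReal.abs_def] at h
        exact (ENNReal.ofReal_le_ofReal_iff (add_nonneg
          (mul_nonneg (hl₁_nonneg s hs) (norm_nonneg _))
          (mul_nonneg (hl₂_nonneg s hs) (norm_nonneg _)))).1 h
      l₀_nonneg := hl₀_nonneg
      l₁_nonneg := hl₁_nonneg
      l₂_nonneg := hl₂_nonneg
      l₀_integrableOn := hl₀
      l₁_integrableOn := hl₁
      l₂_integrableOn := hl₂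
      integrableOn_growth := by
        refine H7.congr_fun (fun s hs => ?_) measurableSet_Ici
        simp only [integral_indicator_Ici_interval _ le_rfl hs, hind _ s hs]
      integrableOn_l₂γ₀ := by
        refine H7'.congr_fun (fun s hs => ?_) measurableSet_Ici
        simp only [hind _ s hs] }
  have hV : ∀ t, 0 ≤ t → ∀ ξ, valueFunction L Γ t ξ = _ :=
    fun t ht ξ => hP.valueFunction_eq hreal ht ξ
  refine ⟨fun D hD => ?_, ?_, lipschitzRank l₁ l₂ ((Ici 0).indicator γ₁),
    fun t ht => hP.lipschitzRank_nonneg ht, hP.continuousOn_lipschitzRank,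
    hP.antitoneOn_lipschitzRank, hP.tendsto_lipschitzRank, fun t ht ξ ξ' => ?_⟩
  · obtain ⟨r, hr⟩ := hD.exists_norm_le
    refine ⟨∫ s in Ici 0,
      costBound l₀ l₁ l₂ ((Ici 0).indicator γ₀) ((Ici 0).indicator γ₁) r s, fun t ht ξ hξ => ?_⟩
    have h := abs_le.1 (hP.abs_realValue_le ht (hr ξ hξ))
    rw [hV t ht ξ]
    exact ⟨EReal.coe_le_coe_iff.2 h.1, EReal.coe_le_coe_iff.2 h.2⟩
  · exact ((continuous_coe_real_ereal.comp_continuousOn hP.continuousOn_realValue).congr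
      fun p hp => hV p.1 hp.1 p.2).lowerSemicontinuousOn
  · rw [hV t ht ξ, hV t ht ξ', ← EReal.coe_sub, EReal.abs_def]
    exact ENNReal.ofReal_le_ofReal (hP.abs_realValue_sub_le ht ξ ξ')
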